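/- Let $\mathfrak g=\mathfrak g_{\bar 0}\oplus\mathfrak g_{\bar 1}$ be a finite-dimensional contragredient Lie superalgebra over $\mathbb C$ with Cartan subalgebra $\mathfrak h\subset\mathfrak g_{\bar 0}$. That is, $\mathfrak h$ is abelian and there are linearly independent $\alpha_1,\dots,\alpha_n\in\mathfrak h^*$, linearly independent $h_1,\dots,h_n\in\mathfrak h$ and homogeneous $e_i,f_i$ (with $e_i$ and $f_i$ of equal parity) such that $\mathfrak h,e_i,f_i$ generate $\mathfrak g$, $[a,e_i]=\alpha_i(a)e_i$, $[a,f_i]=-\alpha_i(a)f_i$ for $a\in\mathfrak h$, $[e_i,f_j]=\delta_{ij}h_i$, and no nonzero ideal of $\mathfrak g$ meets $\mathfrak h$ trivially. (This includes $\mathfrak{gl}(m|n)$.) Let $x\in\mathfrak g_{\bar 1}$ be nonzero with $[x,x]=0$. Put $\mathfrak g^x=\{a\in\mathfrak g\mid [x,a]=0\}$ and $\mathfrak g_x=\mathfrak g^x/[x,\mathfrak g]$, and for a finite-dimensional $\mathfrak g$-module $M$ put $DS_x(M)=M_x=\ker_M x/xM$, which is a $\mathfrak g_x$-module. For a Lie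 superalgebra $\mathfrak a$, let $\mathcal K_{\mathfrak a}$ be the quotient of the Grothendieck ring of the category of finite-dimensional $\mathfrak a$-modules (with product given by $\otimes$) by the ideal generated by all $[\Pi M]+[M]$, where $\Pi$ is the parity shift. For a Cartan subalgebra $\mathfrak t$ of $\mathfrak a_{\bar 0}$, let $$\operatorname{sch}_{\mathfrak t}M=\sum_{\mu\in\mathfrak t^*}(\dim M^\mu_{\bar 0}-\dim M^\mu_{\bar 1})\,e^\mu\in\mathbb Z[\mathfrak t^*],$$ where $M^\mu$ are the (generalized) weight spaces, and let $\mathcal J_{\mathfrak a}=\mathcal J_{\mathfrak a,\mathfrak t}\subset\mathbb Z[\mathfrak t^*]$ be the supercharacter ring, i.e. the subring generated by all supercharacters. Then: 1. There is a unique ring homomorphism $ds_x:\mathcal K_{\mathfrak g}\to\mathcal K_{\mathfrak g_x}$ with $ds_x([M])=[M_x]$ for every finite-dimensional $\mathfrak g$-module $M$. 2. For every Cartan subalgebra $\mathfrak t$ of $(\mathfrak g_x)_{\bar 0}$, the rings $\mathcal J_{\mathfrak g}=\mathcal J_{\mathfrak g,\mathfrak h}$ and $\mathcal J_{\mathfrak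 g_x}=\mathcal J_{\mathfrak g_x,\mathfrak t}$ consist exactly of the supercharacters of finite-dimensional modules, and there is a unique ring homomorphism $ds_x:\mathcal J_{\mathfrak g}\to\mathcal J_{\mathfrak g_x}$ with $ds_x(\operatorname{sch}_{\mathfrak h}M)=\operatorname{sch}_{\mathfrak t}M_x$ for every finite-dimensional $\mathfrak g$-module $M$. 3. If moreover $\mathfrak t=\mathfrak h_x$ is embedded in $\mathfrak h$, i.e. $\iota:\mathfrak t\to\mathfrak h$ is linear, and for all $a\in\mathfrak t$ one has $\iota(a)\in\mathfrak g^x$ and the class of $\iota(a)$ in $\mathfrak g_x$ is $a$, then $\operatorname{sch}_{\mathfrak t}M_x$ is the restriction of $\operatorname{sch}_{\mathfrak h}M$ along $\iota$ (that is, $e^\mu\mapsto e^{\mu\circ\iota}$). -/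

import Mathlib

universe u v

noncomputable section

namespace Super

/-- The sign `(-1)^i` for `i ∈ ℤ/2`. -/
def sgn (i : ZMod 2) : ℂ := if i = 0 then 1 else -1

/-- A `ℤ/2`-grading `V = V_0 ⊕ V_1` of a complex vector space is given by its parity
involution `θ`, which acts by `(-1)^i` on `V_i`; `homog θ i` is the component `V_i`. -/
def homog {V : Type*} [AddCommGroup V] [Module ℂ V] (θ : V →ₗ[ℂ] V) (i : ZMod 2) :
    Submodule ℂ V :=
  LinearMap.ker (θ - sgn i • LinearMap.id)

section Grading

theorem zmod_two_cases (i : ZMod 2) : i = 0 ∨ i = 1 := by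
  revert i; decide

@[simp] theorem sgn_zero : sgn 0 = 1 := by simp [sgn]

@[simp] theorem sgn_one : sgn 1 = -1 := by simp [sgn]

theorem sgn_add (i j : ZMod 2) : sgn (i + j) = sgn i * sgn j := by
  have h2 : (1 : ZMod 2) + 1 = 0 := by decide
  rcases zmod_two_cases i with rfl | rfl <;> rcases zmod_two_cases j with rfl | rfl <;>
    simp [h2]

theorem sgn_sq (i : ZMod 2) : sgn i * sgn i = 1 := by
  rcases zmod_two_cases i with rfl | rfl <;> simp

variable {V : Type*} [AddCommGroup V] [Module ℂ V]

theorem mem_homog {θ : V →ₗ[ℂ] V} {i : ZMod 2} {v : V} :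
    v ∈ homog θ i ↔ θ v = sgn i • v := by
  simp [homog, sub_eq_zero]

/-- The projection of `V` onto the component `V_i`. -/
def proj (θ : V →ₗ[ℂ] V) (i : ZMod 2) : V →ₗ[ℂ] V :=
  (1 / 2 : ℂ) • (LinearMap.id + sgn i • θ)

theorem proj_apply (θ : V →ₗ[ℂ] V) (i : ZMod 2) (v : V) :
    proj θ i v = (1 / 2 : ℂ) • (v + sgn i • θ v) := rfl

theorem proj_mem {θ : V →ₗ[ℂ] V} (hθ : ∀ v, θ (θ v) = v) (i : ZMod 2) (v : V) :
    proj θ i v ∈ homog θ i := by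
  rw [mem_homog, proj_apply]
  simp only [map_smul, map_add, hθ, smul_add, smul_smul]
  rw [show sgn i * (1 / 2 * sgn i) = 1 / 2 by linear_combination (1 / 2) * sgn_sq i]
  rw [add_comm, mul_comm (sgn i)]

theorem proj_add (θ : V →ₗ[ℂ] V) (v : V) : proj θ 0 v + proj θ 1 v = v := by
  simp only [proj_apply, sgn_zero, sgn_one]
  module

theorem proj_of_mem {θ : V →ₗ[ℂ] V} {i : ZMod 2} {v : V} (h : v ∈ homog θ i) (j : ZMod 2) :
    proj θ j v = if i = j then v else 0 := by
  rw [mem_homog] at h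
  rw [proj_apply, h]
  rcases zmod_two_cases i with rfl | rfl <;> rcases zmod_two_cases j with rfl | rfl <;>
    simp <;> module

theorem homog_induction {θ : V →ₗ[ℂ] V} (hθ : ∀ v, θ (θ v) = v) {p : V → Prop}
    (hom : ∀ i, ∀ v ∈ homog θ i, p v) (add : ∀ v w, p v → p w → p (v + w)) (v : V) : p v := by
  rw [← proj_add θ v]
  exact add _ _ (hom 0 _ (proj_mem hθ 0 v)) (hom 1 _ (proj_mem hθ 1 v))

/-- An involution really is a grading: `V = V_0 ⊕ V_1`. -/
theorem isCompl_homog {θ : V →ₗ[ℂ] V} (hθ : ∀ v, θ (θ v) = v) :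
    IsCompl (homog θ 0) (homog θ 1) := by
  constructor
  · rw [Submodule.disjoint_def]
    intro v h0 h1
    have := proj_of_mem h0 0
    rw [proj_of_mem h1 0] at this
    simpa using this.symm
  · rw [codisjoint_iff_le_sup]
    intro v _
    rw [← proj_add θ v]
    exact Submodule.add_mem_sup (proj_mem hθ 0 v) (proj_mem hθ 1 v)

end Grading

/-- A complex Lie superalgebra: a `ℤ/2`-graded vector space `g` (graded by the involution `par`)
with an even bilinear bracket that is super-skew-symmetric and satisfies the super Jacobi
identity. -/
class LieSuperalgebra (g : Type u) [AddCommGroup g] [Module ℂ g] where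
  par : g →ₗ[ℂ] g
  par_par : ∀ a, par (par a) = a
  br : g →ₗ[ℂ] g →ₗ[ℂ] g
  br_mem : ∀ {i j : ZMod 2} {a b : g}, a ∈ homog par i → b ∈ homog par j →
    br a b ∈ homog par (i + j)
  br_skew : ∀ {i j : ZMod 2} {a b : g}, a ∈ homog par i → b ∈ homog par j →
    br a b = -(sgn (i * j) • br b a)
  br_jacobi : ∀ {i j k : ZMod 2} {a b c : g},
    a ∈ homog par i → b ∈ homog par j → c ∈ homog par k →
    br a (br b c) = br (br a b) c + sgn (i * j) • br b (br a c)

/-- The homogeneous component `g_i` of a Lie superalgebra. -/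
abbrev part (g : Type u) [AddCommGroup g] [Module ℂ g] [LieSuperalgebra g] (i : ZMod 2) :
    Submodule ℂ g :=
  homog (LieSuperalgebra.par (g := g)) i

open LieSuperalgebra

section EvenPart

variable (g : Type u) [AddCommGroup g] [Module ℂ g] [LieSuperalgebra g]

variable {g} in
theorem br_even_mem {a b : g} (ha : a ∈ part g 0) (hb : b ∈ part g 0) : br a b ∈ part g 0 := by
  simpa using br_mem ha hb

variable {g} in
theorem br_even_skew {a b : g} (ha : a ∈ part g 0) (hb : b ∈ part g 0) :
    br a b = -br b a := by
  simpa using br_skew ha hb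

/-- The even part `g_0` is an ordinary Lie algebra. -/
instance evenLieRing : LieRing (part g 0) where
  bracket a b := ⟨br (a : g) (b : g), br_even_mem a.2 b.2⟩
  add_lie a b c := Subtype.ext (by simp)
  lie_add a b c := Subtype.ext (by simp)
  lie_self a := Subtype.ext (by
    have h := br_even_skew a.2 a.2
    have h2 : (2 : ℂ) • br (a : g) (a : g) = 0 := by
      rw [two_smul]; exact eq_neg_iff_add_eq_zero.mp h
    simpa using h2)
  leibniz_lie a b c := Subtype.ext (by simpa using br_jacobi a.2 b.2 c.2)

instance evenLieAlgebra : LieAlgebra ℂ (part g 0) where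
  lie_smul t a b := Subtype.ext (by
    change br (a : g) ((t • b : part g 0) : g) = t • br (a : g) (b : g)
    simp)

end EvenPart

/-- A representation of a Lie superalgebra `g` on a vector space `V`: a `ℤ/2`-grading of `V`
(with parity involution `par`) and a compatible action of `g` with
`[a,b] v = a (b v) - (-1)^{|a||b|} b (a v)` for homogeneous `a`, `b`. -/
structure SuperRep (g : Type u) [AddCommGroup g] [Module ℂ g] [LieSuperalgebra g]
    (V : Type v) [AddCommGroup V] [Module ℂ V] where
  par : V →ₗ[ℂ] V
  par_par : ∀ m, par (par m) = m
  act : g →ₗ[ℂ] Module.End ℂ V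
  act_mem : ∀ {i j : ZMod 2} {a : g} {m : V}, a ∈ part g i → m ∈ homog par j →
    act a m ∈ homog par (i + j)
  act_br : ∀ {i j : ZMod 2} {a b : g}, a ∈ part g i → b ∈ part g j → ∀ m : V,
    act (br a b) m = act a (act b m) - sgn (i * j) • act b (act a m)

namespace SuperRep

variable {g : Type u} [AddCommGroup g] [Module ℂ g] [LieSuperalgebra g]
variable {V : Type v} [AddCommGroup V] [Module ℂ V]

theorem par_act (R : SuperRep g V) (a : g) (m : V) :
    R.par (R.act a m) = R.act (LieSuperalgebra.par a) (R.par m) := by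
  induction a using homog_induction (LieSuperalgebra.par_par (g := g)) with
  | add a b ha hb => simp [ha, hb]
  | hom i a ha =>
    induction m using homog_induction R.par_par with
    | add m n hm hn => simp [hm, hn]
    | hom j m hm =>
      have h := mem_homog.mp (R.act_mem ha hm)
      rw [h, mem_homog.mp ha, mem_homog.mp hm, sgn_add]
      simp [smul_smul, mul_comm]

/-- A representation from an even action. -/
def mk' (par : V →ₗ[ℂ] V) (par_par : ∀ m, par (par m) = m) (act : g →ₗ[ℂ] Module.End ℂ V)
    (par_act : ∀ a m, par (act a m) = act (LieSuperalgebra.par a) (par m))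
    (act_br : ∀ {i j : ZMod 2} {a b : g}, a ∈ part g i → b ∈ part g j → ∀ m : V,
      act (br a b) m = act a (act b m) - sgn (i * j) • act b (act a m)) : SuperRep g V where
  par := par
  par_par := par_par
  act := act
  act_mem {i j a m} ha hm := by
    rw [mem_homog, par_act, mem_homog.mp ha, mem_homog.mp hm, sgn_add]
    simp [smul_smul, mul_comm]
  act_br := act_br

variable (g) in
/-- The adjoint representation. -/
def adjoint : SuperRep g g where
  par := LieSuperalgebra.par
  par_par := LieSuperalgebra.par_par
  act := br
  act_mem ha hm := br_mem ha hm
  act_br {i j a b} ha hb m := by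
    induction m using homog_induction (LieSuperalgebra.par_par (g := g)) with
    | add m n hm hn => simp only [map_add, smul_add, hm, hn]; abel
    | hom k m hm => rw [br_jacobi ha hb hm]; abel

/-- The restriction of a representation to the Lie algebra `g_0`. -/
abbrev evenLieRingModule (R : SuperRep g V) : LieRingModule (part g 0) V where
  bracket a m := R.act (a : g) m
  add_lie a b m := by simp
  lie_add a m n := by simp
  leibniz_lie a b m := by
    change R.act a (R.act b m) = R.act (br (a : g) (b : g)) m + R.act b (R.act a m)
    rw [R.act_br a.2 b.2]; simp

end SuperRep

/-- The set `X_g` of odd elements `x` with `[x,x] = 0`. -/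
structure SelfCommuting (g : Type u) [AddCommGroup g] [Module ℂ g] [LieSuperalgebra g] where
  elt : g
  odd : elt ∈ part g 1
  sq : br elt elt = 0

namespace SuperRep

variable {g : Type u} [AddCommGroup g] [Module ℂ g] [LieSuperalgebra g]
variable {V : Type v} [AddCommGroup V] [Module ℂ V]

/-- The cohomology `V_x = ker x / x V`. -/
def Coh (R : SuperRep g V) (x : SelfCommuting g) : Type v :=
  LinearMap.ker (R.act x.elt) ⧸ (LinearMap.range (R.act x.elt)).submoduleOf (LinearMap.ker (R.act x.elt))

section

variable (R : SuperRep g V) (x : SelfCommuting g)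

instance : AddCommGroup (R.Coh x) := Submodule.Quotient.addCommGroup _

instance : Module ℂ (R.Coh x) := Submodule.Quotient.module _

instance [FiniteDimensional ℂ V] : FiniteDimensional ℂ (R.Coh x) :=
  Module.Finite.quotient ℂ _

/-- The class in `V_x` of an element of `ker x`. -/
def cls : LinearMap.ker (R.act x.elt) →ₗ[ℂ] R.Coh x := Submodule.mkQ _

theorem cls_surjective : Function.Surjective (R.cls x) := Submodule.mkQ_surjective _

theorem cls_eq_zero {m : LinearMap.ker (R.act x.elt)} :
    R.cls x m = 0 ↔ ∃ n, R.act x.elt n = (m : V) := by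
  exact (Submodule.Quotient.mk_eq_zero _).trans Iff.rfl

theorem par_x (m : V) : R.par (R.act x.elt m) = -R.act x.elt (R.par m) := by
  rw [R.par_act, mem_homog.mp x.odd]; simp

theorem act_br_x (a : g) (m : V) :
    R.act (br x.elt a) m = R.act x.elt (R.act a m) - R.act (LieSuperalgebra.par a) (R.act x.elt m) := by
  induction a using homog_induction (LieSuperalgebra.par_par (g := g)) with
  | add a b ha hb => simp only [map_add, LinearMap.add_apply, ha, hb]; abel
  | hom i a ha => rw [R.act_br x.odd ha, mem_homog.mp ha]; simp

theorem par_centralizer {a : g} (ha : br x.elt a = 0) : br x.elt (LieSuperalgebra.par a) = 0 := by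
  have h := (adjoint g).par_x x a
  change LieSuperalgebra.par (br x.elt a) = -br x.elt (LieSuperalgebra.par a) at h
  rw [ha, map_zero] at h
  exact neg_eq_zero.mp h.symm

theorem act_mem_ker {a : g} (ha : br x.elt a = 0) {m : V} (hm : R.act x.elt m = 0) :
    R.act x.elt (R.act a m) = 0 := by
  have h := R.act_br_x x a m
  rw [ha, hm] at h
  simpa using h.symm

theorem act_x_comm {a : g} (ha : br x.elt a = 0) (m : V) :
    R.act a (R.act x.elt m) = R.act x.elt (R.act (LieSuperalgebra.par a) m) := by
  have h := R.act_br_x x (LieSuperalgebra.par a) m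
  rw [par_centralizer x ha, LieSuperalgebra.par_par] at h
  simpa using (sub_eq_zero.mp (by simpa using h.symm)).symm

/-- The grading of `V_x`. -/
def cohPar : R.Coh x →ₗ[ℂ] R.Coh x :=
  Submodule.mapQ _ _
    (R.par.restrict (p := LinearMap.ker (R.act x.elt)) (q := LinearMap.ker (R.act x.elt))
      (fun m hm => by
        have h := R.par_x x m
        rw [LinearMap.mem_ker] at hm ⊢
        rw [hm, map_zero] at h
        exact neg_eq_zero.mp h.symm))
    (by
      rintro ⟨m, hm⟩ ⟨n, hn⟩
      refine ⟨-R.par n, ?_⟩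
      change R.act x.elt n = m at hn
      change R.act x.elt (-R.par n) = R.par m
      rw [← hn, R.par_x, map_neg])

/-- The endomorphism of `V_x` induced by an element of the centralizer `g^x`. -/
def cohEnd (a : LinearMap.ker ((adjoint g).act x.elt)) : Module.End ℂ (R.Coh x) :=
  Submodule.mapQ _ _
    ((R.act (a : g)).restrict (p := LinearMap.ker (R.act x.elt)) (q := LinearMap.ker (R.act x.elt))
      (fun _ hm => R.act_mem_ker x a.2 hm))
    (by
      rintro ⟨m, hm⟩ ⟨n, hn⟩
      refine ⟨R.act (LieSuperalgebra.par (a : g)) n, ?_⟩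
      change R.act x.elt n = m at hn
      change R.act x.elt _ = R.act (a : g) m
      rw [← hn, R.act_x_comm x a.2])

theorem cohEnd_cls (a : LinearMap.ker ((adjoint g).act x.elt)) (m : LinearMap.ker (R.act x.elt)) :
    R.cohEnd x a (R.cls x m) = R.cls x ⟨R.act (a : g) m, R.act_mem_ker x a.2 m.2⟩ := rfl

theorem cohPar_cls (m : LinearMap.ker (R.act x.elt)) (h : R.act x.elt (R.par m) = 0) :
    R.cohPar x (R.cls x m) = R.cls x ⟨R.par m, h⟩ := rfl

/-- The action of `g_x = g^x / [x,g]` on `V_x`, induced by the action of `g^x` on `ker x`. -/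
def cohAct : (adjoint g).Coh x →ₗ[ℂ] Module.End ℂ (R.Coh x) :=
  Submodule.liftQ _
    { toFun := R.cohEnd x
      map_add' := fun a b => by
        ext m
        obtain ⟨m, rfl⟩ := R.cls_surjective x m
        simp only [LinearMap.add_apply, cohEnd_cls, ← map_add]
        congr 1
        ext
        simp
      map_smul' := fun t a => by
        ext m
        obtain ⟨m, rfl⟩ := R.cls_surjective x m
        simp only [LinearMap.smul_apply, cohEnd_cls, ← map_smul, RingHom.id_apply]
        congr 1
        ext
        simp }
    (by
      rintro ⟨a, ha⟩ ⟨b, hb⟩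
      change br x.elt b = a at hb
      rw [LinearMap.mem_ker]
      ext m
      obtain ⟨m, rfl⟩ := R.cls_surjective x m
      change R.cohEnd x _ (R.cls x m) = 0
      rw [cohEnd_cls, cls_eq_zero]
      refine ⟨R.act b m, ?_⟩
      have h := R.act_br_x x b m
      rw [LinearMap.mem_ker.mp m.2, map_zero, sub_zero] at h
      change _ = R.act a m
      rw [← h, hb])

theorem cohAct_cls (a : LinearMap.ker ((adjoint g).act x.elt)) (m : LinearMap.ker (R.act x.elt)) :
    R.cohAct x ((adjoint g).cls x a) (R.cls x m) =
      R.cls x ⟨R.act (a : g) m, R.act_mem_ker x a.2 m.2⟩ := rfl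

theorem par_mem_ker {m : V} (hm : R.act x.elt m = 0) : R.act x.elt (R.par m) = 0 := by
  have h := R.par_x x m
  rw [hm, map_zero] at h
  exact neg_eq_zero.mp h.symm

theorem cohPar_cohPar (m : R.Coh x) : R.cohPar x (R.cohPar x m) = m := by
  obtain ⟨m, rfl⟩ := R.cls_surjective x m
  rw [cohPar_cls _ _ _ (R.par_mem_ker x m.2),
    cohPar_cls _ _ _ (R.par_mem_ker x (R.par_mem_ker x m.2))]
  congr 1
  ext
  exact R.par_par m

theorem cohPar_cohAct (a : (adjoint g).Coh x) (m : R.Coh x) :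
    R.cohPar x (R.cohAct x a m) = R.cohAct x ((adjoint g).cohPar x a) (R.cohPar x m) := by
  obtain ⟨m, rfl⟩ := R.cls_surjective x m
  obtain ⟨a, rfl⟩ := (adjoint g).cls_surjective x a
  rw [cohAct_cls, cohPar_cls _ _ _ (R.par_mem_ker x (R.act_mem_ker x a.2 m.2)),
    cohPar_cls _ _ _ (R.par_mem_ker x m.2), cohPar_cls _ _ _ ((adjoint g).par_mem_ker x a.2),
    cohAct_cls]
  congr 1
  ext
  exact R.par_act a m

/-- Homogeneous classes have homogeneous representatives. -/
theorem exists_homog_rep {i : ZMod 2} {m : R.Coh x} (hm : m ∈ homog (R.cohPar x) i) :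
    ∃ n : LinearMap.ker (R.act x.elt), (n : V) ∈ homog R.par i ∧ R.cls x n = m := by
  obtain ⟨n, rfl⟩ := R.cls_surjective x m
  have hp : R.act x.elt (proj R.par i n) = 0 := by
    rw [proj_apply]
    simp [LinearMap.mem_ker.mp n.2, R.par_mem_ker x n.2]
  refine ⟨⟨proj R.par i n, hp⟩, proj_mem R.par_par i _, ?_⟩
  have h : R.cls x ⟨proj R.par i n, hp⟩ = proj (R.cohPar x) i (R.cls x n) := by
    rw [proj_apply (R.cohPar x), cohPar_cls _ _ _ (R.par_mem_ker x n.2), ← map_smul, ← map_add, ← map_smul]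
    rfl
  rw [h, proj_of_mem hm]
  simp

theorem cohAct_br {i j : ZMod 2} {a b : (adjoint g).Coh x}
    (ha : a ∈ homog ((adjoint g).cohPar x) i) (hb : b ∈ homog ((adjoint g).cohPar x) j)
    (m : R.Coh x) :
    R.cohAct x ((adjoint g).cohAct x a b) m =
      R.cohAct x a (R.cohAct x b m) - sgn (i * j) • R.cohAct x b (R.cohAct x a m) := by
  obtain ⟨m, rfl⟩ := R.cls_surjective x m
  obtain ⟨a, ha', rfl⟩ := (adjoint g).exists_homog_rep x ha
  obtain ⟨b, hb', rfl⟩ := (adjoint g).exists_homog_rep x hb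
  simp only [cohAct_cls, ← map_smul, ← map_sub]
  congr 1
  ext
  exact R.act_br ha' hb' m

end

end SuperRep

/-- The Lie superalgebra `g_x = g^x / [x,g]`, where `g^x` is the centralizer of `x` in `g`. -/
abbrev DSAlg {g : Type u} [AddCommGroup g] [Module ℂ g] [LieSuperalgebra g]
    (x : SelfCommuting g) : Type u :=
  (SuperRep.adjoint g).Coh x

section

variable {g : Type u} [AddCommGroup g] [Module ℂ g] [LieSuperalgebra g]

/-- The bracket of `g_x` is induced by the bracket of `g`. -/
instance (x : SelfCommuting g) : LieSuperalgebra (DSAlg x) where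
  par := (SuperRep.adjoint g).cohPar x
  par_par := (SuperRep.adjoint g).cohPar_cohPar x
  br := (SuperRep.adjoint g).cohAct x
  br_mem {i j a b} ha hb := by
    rw [mem_homog, SuperRep.cohPar_cohAct, mem_homog.mp ha, mem_homog.mp hb, sgn_add]
    simp [smul_smul, mul_comm]
  br_skew {i j a b} ha hb := by
    obtain ⟨a, ha', rfl⟩ := (SuperRep.adjoint g).exists_homog_rep x ha
    obtain ⟨b, hb', rfl⟩ := (SuperRep.adjoint g).exists_homog_rep x hb
    simp only [SuperRep.cohAct_cls, ← map_smul, ← map_neg]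
    congr 1
    ext
    exact br_skew ha' hb'
  br_jacobi {i j k a b c} ha hb _ := by
    rw [(SuperRep.adjoint g).cohAct_br x ha hb c]; abel

/-- `V_x` is a representation of `g_x`. -/
def SuperRep.ds {V : Type v} [AddCommGroup V] [Module ℂ V] (R : SuperRep g V)
    (x : SelfCommuting g) : SuperRep (DSAlg x) (R.Coh x) :=
  .mk' (R.cohPar x) (R.cohPar_cohPar x) (R.cohAct x) (R.cohPar_cohAct x)
    (fun ha hb m => R.cohAct_br x ha hb m)

end

open TensorProduct

theorem sgn_mul_add (i j k : ZMod 2) : sgn (i * (j + k)) = sgn (i * j) * sgn (i * k) := by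
  rw [mul_add, sgn_add]

theorem sgn_add_mul (i j k : ZMod 2) : sgn ((i + j) * k) = sgn (i * k) * sgn (j * k) := by
  rw [add_mul, sgn_add]

namespace SuperRep

variable {g : Type u} [AddCommGroup g] [Module ℂ g] [LieSuperalgebra g]
variable {V W : Type v} [AddCommGroup V] [Module ℂ V] [AddCommGroup W] [Module ℂ W]

/-- The action of `g` on a tensor product:
`a (m ⊗ n) = a m ⊗ n + (-1)^{|a||m|} m ⊗ a n`. -/
def tensorAct (R : SuperRep g V) (S : SuperRep g W) : g →ₗ[ℂ] Module.End ℂ (V ⊗[ℂ] W) where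
  toFun a := map (R.act a) LinearMap.id +
    map LinearMap.id (S.act (proj LieSuperalgebra.par 0 a)) +
    map R.par (S.act (proj LieSuperalgebra.par 1 a))
  map_add' a b := by
    ext m n
    simp [TensorProduct.add_tmul, TensorProduct.tmul_add]
    abel
  map_smul' t a := by
    ext m n
    simp [TensorProduct.smul_tmul']

theorem tensorAct_tmul (R : SuperRep g V) (S : SuperRep g W) {i k : ZMod 2} {a : g} {m : V}
    (ha : a ∈ part g i) (hm : m ∈ homog R.par k) (n : W) :
    tensorAct R S a (m ⊗ₜ n) = R.act a m ⊗ₜ n + sgn (i * k) • (m ⊗ₜ S.act a n) := by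
  simp only [tensorAct, LinearMap.coe_mk, AddHom.coe_mk, LinearMap.add_apply, map_tmul,
    LinearMap.id_coe, id_eq, proj_of_mem ha, mem_homog.mp hm]
  rcases zmod_two_cases i with rfl | rfl <;> simp [TensorProduct.smul_tmul']

/-- To compare linear maps on `V ⊗ W`, it suffices to look at `m ⊗ n` with `m`, `n` homogeneous. -/
theorem tensor_induction {θ : V →ₗ[ℂ] V} {η : W →ₗ[ℂ] W} (hθ : ∀ v, θ (θ v) = v)
    (hη : ∀ v, η (η v) = v) {p : V ⊗[ℂ] W → Prop} (zero : p 0)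
    (tmul : ∀ i j, ∀ m ∈ homog θ i, ∀ n ∈ homog η j, p (m ⊗ₜ n))
    (add : ∀ s t, p s → p t → p (s + t)) (t : V ⊗[ℂ] W) : p t := by
  induction t using TensorProduct.induction_on with
  | zero => exact zero
  | add s t hs ht => exact add s t hs ht
  | tmul m n =>
    induction m using homog_induction hθ with
    | add m m' hm hm' => rw [TensorProduct.add_tmul]; exact add _ _ hm hm'
    | hom i m hm =>
      induction n using homog_induction hη with
      | add n n' hn hn' => rw [TensorProduct.tmul_add]; exact add _ _ hn hn'
      | hom j n hn => exact tmul i j m hm n hn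

theorem tmul_mem {R : SuperRep g V} {S : SuperRep g W} {i j : ZMod 2} {m : V} {n : W}
    (hm : m ∈ homog R.par i) (hn : n ∈ homog S.par j) :
    m ⊗ₜ n ∈ homog (map R.par S.par) (i + j) := by
  rw [mem_homog, map_tmul, mem_homog.mp hm, mem_homog.mp hn, sgn_add]
  simp [TensorProduct.smul_tmul', smul_smul, mul_comm]

/-- The tensor product of two representations. -/
def tensor (R : SuperRep g V) (S : SuperRep g W) : SuperRep g (V ⊗[ℂ] W) where
  par := map R.par S.par
  par_par t := by
    induction t using TensorProduct.induction_on with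
    | zero => simp
    | add s t hs ht => simp only [map_add, hs, ht]
    | tmul m n => simp [R.par_par, S.par_par]
  act := tensorAct R S
  act_mem {i j a t} ha ht := by
    have key : ∀ t, map R.par S.par (tensorAct R S a t) =
        sgn i • tensorAct R S a (map R.par S.par t) := by
      intro t
      induction t using tensor_induction R.par_par S.par_par with
      | zero => simp
      | add s t hs ht => simp only [map_add, hs, ht, smul_add]
      | tmul k l m hm n hn =>
        rw [mem_homog.mp (tmul_mem hm hn), map_smul, tensorAct_tmul R S ha hm, map_add, map_smul,
          mem_homog.mp (tmul_mem (R.act_mem ha hm) hn),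
          mem_homog.mp (tmul_mem hm (S.act_mem ha hn))]
        simp only [sgn_add]
        module
    rw [mem_homog, key, mem_homog.mp ht, map_smul, smul_smul, sgn_add]
  act_br {i j a b} ha hb t := by
    induction t using tensor_induction R.par_par S.par_par with
    | zero => simp
    | add s t hs ht => simp only [map_add, hs, ht, smul_add]; abel
    | tmul k l m hm n hn =>
      rw [tensorAct_tmul R S (br_mem ha hb) hm, tensorAct_tmul R S ha hm,
        tensorAct_tmul R S hb hm, map_add, map_add, map_smul, map_smul,
        tensorAct_tmul R S ha (R.act_mem hb hm), tensorAct_tmul R S ha hm,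
        tensorAct_tmul R S hb (R.act_mem ha hm), tensorAct_tmul R S hb hm,
        R.act_br ha hb, S.act_br ha hb, TensorProduct.sub_tmul, TensorProduct.tmul_sub,
        ← TensorProduct.smul_tmul', TensorProduct.tmul_smul]
      simp only [sgn_add_mul, sgn_mul_add, mul_comm j i]
      have h2 := sgn_sq (i * j)
      generalize sgn (i * j) = s at *
      rcases mul_self_eq_one_iff.mp h2 with rfl | rfl <;> module

variable (g) in
/-- The trivial representation on the even line. -/
def trivial : SuperRep g (ULift.{v} ℂ) where
  par := LinearMap.id
  par_par _ := rfl
  act := 0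
  act_mem _ _ := by simp
  act_br _ _ _ := by simp

/-- The parity shift `Π`. -/
def shift (R : SuperRep g V) : SuperRep g V where
  par := -R.par
  par_par m := by simp [R.par_par]
  act := R.act
  act_mem {i j a m} ha hm := by
    rw [mem_homog] at hm ⊢
    rw [LinearMap.neg_apply, neg_eq_iff_eq_neg] at hm ⊢
    rw [R.par_act, mem_homog.mp ha, hm, sgn_add]
    simp [smul_smul]
  act_br ha hb m := R.act_br ha hb m

/-- Homomorphisms of representations: parity preserving linear maps that commute with `g`. -/
structure IsHom (R : SuperRep g V) (S : SuperRep g W) (f : V →ₗ[ℂ] W) : Prop where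
  map_par : ∀ m, f (R.par m) = S.par (f m)
  map_act : ∀ a m, f (R.act a m) = S.act a (f m)

/-- It suffices to check compatibility with the action on homogeneous elements of `g`. -/
theorem IsHom.of_homog {R : SuperRep g V} {S : SuperRep g W} {f : V →ₗ[ℂ] W}
    (hp : ∀ m, f (R.par m) = S.par (f m))
    (ha : ∀ i, ∀ a ∈ part g i, ∀ m, f (R.act a m) = S.act a (f m)) : IsHom R S f := by
  refine ⟨hp, fun a => ?_⟩
  induction a using homog_induction (LieSuperalgebra.par_par (g := g)) with
  | hom i a h => exact ha i a h
  | add a b ha hb => intro m; simp [ha, hb]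

theorem IsHom.tensor {V' W' : Type v} [AddCommGroup V'] [Module ℂ V'] [AddCommGroup W']
    [Module ℂ W'] {R : SuperRep g V} {S : SuperRep g W} {R' : SuperRep g V'} {S' : SuperRep g W'}
    {e : V →ₗ[ℂ] V'} {f : W →ₗ[ℂ] W'} (he : IsHom R R' e) (hf : IsHom S S' f) :
    IsHom (R.tensor S) (R'.tensor S') (map e f) := by
  refine .of_homog (fun t => ?_) (fun i a ha t => ?_)
  · change map e f (map R.par S.par t) = map R'.par S'.par (map e f t)
    induction t using TensorProduct.induction_on with
    | zero => simp
    | add s t hs ht => simp only [map_add, hs, ht]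
    | tmul m n => simp [he.map_par, hf.map_par]
  · change map e f (tensorAct R S a t) = tensorAct R' S' a (map e f t)
    induction t using tensor_induction R.par_par S.par_par with
    | zero => simp
    | add s t hs ht => simp only [map_add, hs, ht]
    | tmul k l m hm n hn =>
      have hm' : e m ∈ homog R'.par k := by
        rw [mem_homog, ← he.map_par, mem_homog.mp hm, map_smul]
      rw [tensorAct_tmul _ _ ha hm, map_tmul, tensorAct_tmul _ _ ha hm']
      simp [he.map_act, hf.map_act]

theorem isHom_assoc {X : Type v} [AddCommGroup X] [Module ℂ X] (R : SuperRep g V)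
    (S : SuperRep g W) (T : SuperRep g X) :
    IsHom ((R.tensor S).tensor T) (R.tensor (S.tensor T))
      (TensorProduct.assoc ℂ V W X : _ →ₗ[ℂ] _) := by
  refine .of_homog (fun t => ?_) (fun i a ha t => ?_)
  · change TensorProduct.assoc ℂ V W X (map (map R.par S.par) T.par t) =
      map R.par (map S.par T.par) (TensorProduct.assoc ℂ V W X t)
    induction t using TensorProduct.induction_on with
    | zero => simp
    | add s t hs ht => simp only [map_add, hs, ht]
    | tmul s p =>
      induction s using TensorProduct.induction_on with
      | zero => simp
      | add s t hs ht => simp only [TensorProduct.add_tmul, map_add, hs, ht]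
      | tmul m n => simp
  · change TensorProduct.assoc ℂ V W X (tensorAct (R.tensor S) T a t) =
      tensorAct R (S.tensor T) a (TensorProduct.assoc ℂ V W X t)
    induction t using TensorProduct.induction_on with
    | zero => simp
    | add s t hs ht => simp only [map_add, hs, ht]
    | tmul s p =>
      induction s using tensor_induction R.par_par S.par_par with
      | zero => simp
      | add s t hs ht => simp only [TensorProduct.add_tmul, map_add, hs, ht]
      | tmul k l m hm n hn =>
        rw [tensorAct_tmul (R.tensor S) T ha (tmul_mem hm hn) p,
          TensorProduct.assoc_tmul, tensorAct_tmul R (S.tensor T) ha hm]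
        change TensorProduct.assoc ℂ V W X ((tensorAct R S a (m ⊗ₜ n)) ⊗ₜ p + _) =
          _ + _ • m ⊗ₜ (tensorAct S T a (n ⊗ₜ p))
        rw [tensorAct_tmul _ _ ha hm, tensorAct_tmul _ _ ha hn, sgn_mul_add]
        simp only [TensorProduct.add_tmul, map_add, ← TensorProduct.smul_tmul', map_smul,
          TensorProduct.assoc_tmul, TensorProduct.tmul_add, TensorProduct.tmul_smul]
        module

/-- The supersymmetric flip `m ⊗ n ↦ (-1)^{|m||n|} n ⊗ m`. -/
def flip (R : SuperRep g V) (S : SuperRep g W) : V ⊗[ℂ] W →ₗ[ℂ] W ⊗[ℂ] V :=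
  (TensorProduct.comm ℂ V W : _ →ₗ[ℂ] _) ∘ₗ
    (map LinearMap.id (proj S.par 0) + map R.par (proj S.par 1))

theorem flip_tmul (R : SuperRep g V) (S : SuperRep g W) {i j : ZMod 2} {m : V} {n : W}
    (hm : m ∈ homog R.par i) (hn : n ∈ homog S.par j) :
    flip R S (m ⊗ₜ n) = sgn (i * j) • (n ⊗ₜ m) := by
  simp only [flip, LinearMap.comp_apply, LinearMap.add_apply, map_tmul, LinearMap.id_coe, id_eq,
    proj_of_mem hn, mem_homog.mp hm]
  rcases zmod_two_cases j with rfl | rfl <;> simp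

theorem flip_flip (R : SuperRep g V) (S : SuperRep g W) (t : V ⊗[ℂ] W) :
    flip S R (flip R S t) = t := by
  induction t using tensor_induction R.par_par S.par_par with
  | zero => simp
  | add s t hs ht => simp only [map_add, hs, ht]
  | tmul k l m hm n hn =>
    rw [flip_tmul R S hm hn, map_smul, flip_tmul S R hn hm, smul_smul, mul_comm l k, sgn_sq,
      one_smul]

/-- The flip as a linear isomorphism. -/
def flipEquiv (R : SuperRep g V) (S : SuperRep g W) : V ⊗[ℂ] W ≃ₗ[ℂ] W ⊗[ℂ] V :=
  LinearEquiv.ofLinearMap (flip R S) (flip S R) (LinearMap.ext (flip_flip S R))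
    (LinearMap.ext (flip_flip R S))

theorem isHom_flip (R : SuperRep g V) (S : SuperRep g W) :
    IsHom (R.tensor S) (S.tensor R) (flipEquiv R S : _ →ₗ[ℂ] _) := by
  refine .of_homog (fun t => ?_) (fun i a ha t => ?_)
  · change flip R S (map R.par S.par t) = map S.par R.par (flip R S t)
    induction t using tensor_induction R.par_par S.par_par with
    | zero => simp
    | add s t hs ht => simp only [map_add, hs, ht]
    | tmul k l m hm n hn =>
      rw [mem_homog.mp (tmul_mem hm hn), map_smul, flip_tmul R S hm hn, map_smul,
        mem_homog.mp (tmul_mem hn hm), add_comm, smul_comm]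
  · change flip R S (tensorAct R S a t) = tensorAct S R a (flip R S t)
    induction t using tensor_induction R.par_par S.par_par with
    | zero => simp
    | add s t hs ht => simp only [map_add, hs, ht]
    | tmul k l m hm n hn =>
      rw [tensorAct_tmul _ _ ha hm, map_add, map_smul,
        flip_tmul R S (R.act_mem ha hm) hn, flip_tmul R S hm (S.act_mem ha hn),
        flip_tmul R S hm hn, map_smul, tensorAct_tmul _ _ ha hn]
      simp only [sgn_add_mul, sgn_mul_add, mul_comm k i]
      have h2 := sgn_sq (i * k)
      generalize sgn (i * k) = s at *
      rcases mul_self_eq_one_iff.mp h2 with rfl | rfl <;> module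

variable (V) in
/-- The canonical isomorphism `ℂ ⊗ V ≃ V`. -/
def unitEquiv : ULift.{v} ℂ ⊗[ℂ] V ≃ₗ[ℂ] V :=
  (TensorProduct.congr ULift.moduleEquiv (LinearEquiv.refl ℂ V)).trans (TensorProduct.lid ℂ V)

theorem isHom_unitEquiv (R : SuperRep g V) :
    IsHom ((trivial g).tensor R) R (unitEquiv V : _ →ₗ[ℂ] _) := by
  refine .of_homog (fun t => ?_) (fun i a ha t => ?_)
  · change unitEquiv V (map LinearMap.id R.par t) = R.par (unitEquiv V t)
    induction t using TensorProduct.induction_on with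
    | zero => simp
    | add s t hs ht => simp only [map_add, hs, ht]
    | tmul c m => simp [unitEquiv]
  · change unitEquiv V (tensorAct (trivial g) R a t) = R.act a (unitEquiv V t)
    induction t using TensorProduct.induction_on with
    | zero => simp
    | add s t hs ht => simp only [map_add, hs, ht]
    | tmul c m =>
      have hc : c ∈ homog (trivial.{u, v} g).par 0 := by
        rw [mem_homog, sgn_zero, one_smul]; rfl
      rw [tensorAct_tmul _ _ ha hc]
      simp [trivial, unitEquiv]

end SuperRep

/-- A finite-dimensional `g`-module (an object of the category `F_g`). -/
structure SMod (g : Type u) [AddCommGroup g] [Module ℂ g] [LieSuperalgebra g] where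
  carrier : Type v
  [addCommGroup : AddCommGroup carrier]
  [module : Module ℂ carrier]
  [finite : FiniteDimensional ℂ carrier]
  rep : SuperRep g carrier

attribute [instance] SMod.addCommGroup SMod.module SMod.finite

namespace SMod

variable {g : Type u} [AddCommGroup g] [Module ℂ g] [LieSuperalgebra g]

/-- `0 → M₁ → M₂ → M₃ → 0` is exact. -/
def IsShortExact (M₁ M₂ M₃ : SMod.{u, v} g) : Prop :=
  ∃ (f : M₁.carrier →ₗ[ℂ] M₂.carrier) (p : M₂.carrier →ₗ[ℂ] M₃.carrier),
    SuperRep.IsHom M₁.rep M₂.rep f ∧ SuperRep.IsHom M₂.rep M₃.rep p ∧ Function.Injective f ∧ Function.Exact f p ∧ Function.Surjective p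

/-- Isomorphism of `g`-modules. -/
def Iso (M N : SMod.{u, v} g) : Prop :=
  ∃ e : M.carrier ≃ₗ[ℂ] N.carrier, SuperRep.IsHom M.rep N.rep (e : M.carrier →ₗ[ℂ] N.carrier)

/-- The tensor product of two `g`-modules. -/
def tensor (M N : SMod.{u, v} g) : SMod.{u, v} g where
  carrier := M.carrier ⊗[ℂ] N.carrier
  rep := M.rep.tensor N.rep

variable (g) in
/-- The trivial `g`-module. -/
def unit : SMod.{u, v} g where
  carrier := ULift.{v} ℂ
  rep := SuperRep.trivial g

/-- The parity shift `Π M`. -/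
def shift (M : SMod.{u, v} g) : SMod.{u, v} g where
  carrier := M.carrier
  rep := M.rep.shift

/-- The Duflo–Serganova functor on objects: `M ↦ M_x = ker x / x M`, a module over `g_x`. -/
def DS (x : SelfCommuting g) (M : SMod.{u, v} g) : SMod.{u, v} (DSAlg x) where
  carrier := M.rep.Coh x
  rep := M.rep.ds x

theorem Iso.refl (M : SMod.{u, v} g) : Iso M M := ⟨.refl ℂ _, fun _ => rfl, fun _ _ => rfl⟩

theorem Iso.symm {M N : SMod.{u, v} g} : Iso M N → Iso N M := by
  rintro ⟨e, he⟩
  refine ⟨e.symm, fun m => ?_, fun a m => ?_⟩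
  · obtain ⟨m, rfl⟩ := e.surjective m
    have := he.map_par m
    simp only [LinearEquiv.coe_coe] at this ⊢
    rw [← this]; simp
  · obtain ⟨m, rfl⟩ := e.surjective m
    have := he.map_act a m
    simp only [LinearEquiv.coe_coe] at this ⊢
    rw [← this]; simp

theorem Iso.trans {M N P : SMod.{u, v} g} : Iso M N → Iso N P → Iso M P := by
  rintro ⟨e, he⟩ ⟨f, hf⟩
  refine ⟨e.trans f, fun m => ?_, fun a m => ?_⟩
  · have h1 := he.map_par m
    have h2 := hf.map_par (e m)
    simp only [LinearEquiv.coe_coe] at h1 h2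
    simp [h1, h2]
  · have h1 := he.map_act a m
    have h2 := hf.map_act a (e m)
    simp only [LinearEquiv.coe_coe] at h1 h2
    simp [h1, h2]

theorem Iso.tensor {M N M' N' : SMod.{u, v} g} :
    Iso M M' → Iso N N' → Iso (tensor M N) (tensor M' N') := by
  rintro ⟨e, he⟩ ⟨f, hf⟩
  exact ⟨TensorProduct.congr e f, he.tensor hf⟩

theorem tensor_assoc (M N P : SMod.{u, v} g) :
    Iso (tensor (tensor M N) P) (tensor M (tensor N P)) :=
  ⟨TensorProduct.assoc ℂ M.carrier N.carrier P.carrier, M.rep.isHom_assoc N.rep P.rep⟩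

theorem tensor_comm (M N : SMod.{u, v} g) : Iso (tensor M N) (tensor N M) :=
  ⟨M.rep.flipEquiv N.rep, M.rep.isHom_flip N.rep⟩

theorem unit_tensor (M : SMod.{u, v} g) : Iso (tensor (unit g) M) M :=
  ⟨SuperRep.unitEquiv M.carrier, M.rep.isHom_unitEquiv⟩

theorem IsShortExact.tensor {M₁ M₂ M₃ : SMod.{u, v} g} (h : IsShortExact M₁ M₂ M₃)
    (N : SMod.{u, v} g) : IsShortExact (tensor N M₁) (tensor N M₂) (tensor N M₃) := by
  obtain ⟨f, p, hf, hp, inj, ex, surj⟩ := h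
  have hid : SuperRep.IsHom N.rep N.rep LinearMap.id := ⟨fun _ => rfl, fun _ _ => rfl⟩
  exact ⟨f.lTensor N.carrier, p.lTensor N.carrier, hid.tensor hf, hid.tensor hp,
    Module.Flat.lTensor_preserves_injective_linearMap f inj,
    lTensor_exact N.carrier ex surj, LinearMap.lTensor_surjective N.carrier surj⟩

variable (g) in
/-- Isomorphism classes of finite-dimensional `g`-modules. -/
instance isoSetoid : Setoid (SMod.{u, v} g) where
  r := Iso
  iseqv := ⟨Iso.refl, Iso.symm, Iso.trans⟩

end SMod

section Grothendieck

variable (g : Type u) [AddCommGroup g] [Module ℂ g] [LieSuperalgebra g]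

/-- Isomorphism classes of finite-dimensional `g`-modules. -/
def IsoClass : Type max u (v + 1) := Quotient (SMod.isoSetoid.{u, v} g)

/-- Isomorphism classes form a commutative monoid under the tensor product. -/
instance : CommMonoid (IsoClass.{u, v} g) where
  mul := Quotient.map₂ SMod.tensor (fun _ _ h _ _ h' => SMod.Iso.tensor h h')
  one := Quotient.mk _ (SMod.unit g)
  mul_assoc := by
    rintro ⟨M⟩ ⟨N⟩ ⟨P⟩
    exact Quotient.sound (SMod.tensor_assoc M N P)
  mul_comm := by
    rintro ⟨M⟩ ⟨N⟩
    exact Quotient.sound (SMod.tensor_comm M N)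
  one_mul := by
    rintro ⟨M⟩
    exact Quotient.sound (SMod.unit_tensor M)
  mul_one := by
    rintro ⟨M⟩
    exact Quotient.sound ((SMod.tensor_comm M _).trans (SMod.unit_tensor M))

variable {g} in
/-- The generator attached to `M` of the free abelian group on isomorphism classes. -/
def gen (M : SMod.{u, v} g) : FreeAbelianGroup (IsoClass.{u, v} g) :=
  FreeAbelianGroup.of (Quotient.mk _ M)

/-- The relations `[M₁] - [M₂] + [M₃]` for exact sequences `0 → M₁ → M₂ → M₃ → 0`. -/
def exactRelations : Set (FreeAbelianGroup (IsoClass.{u, v} g)) :=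
  {r | ∃ M₁ M₂ M₃ : SMod.{u, v} g, SMod.IsShortExact M₁ M₂ M₃ ∧ r = gen M₁ - gen M₂ + gen M₃}

/-- The subgroup generated by the relations of exact sequences, which is an ideal for the product
given by tensor products. -/
def exactIdeal : Ideal (FreeAbelianGroup (IsoClass.{u, v} g)) where
  carrier := AddSubgroup.closure (exactRelations.{u, v} g)
  add_mem' := add_mem
  zero_mem' := zero_mem _
  smul_mem' c r hr := by
    change c * r ∈ AddSubgroup.closure (exactRelations.{u, v} g)
    induction hr using AddSubgroup.closure_induction with
    | zero => simp
    | add r s _ _ hr hs => rw [mul_add]; exact add_mem hr hs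
    | neg r _ hr => rw [mul_neg]; exact neg_mem hr
    | mem r hr =>
      obtain ⟨M₁, M₂, M₃, h, rfl⟩ := hr
      induction c using FreeAbelianGroup.induction_on with
      | zero => simp
      | neg c hc => rw [neg_mul]; exact neg_mem hc
      | add c d hc hd => rw [add_mul]; exact add_mem hc hd
      | of c =>
        obtain ⟨N⟩ := c
        refine AddSubgroup.subset_closure ⟨_, _, _, h.tensor N, ?_⟩
        simp only [mul_add, mul_sub]
        rfl

/-- The Grothendieck ring of the category of finite-dimensional `g`-modules. -/
abbrev GrothendieckRing : Type max u (v + 1) :=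
  FreeAbelianGroup (IsoClass.{u, v} g) ⧸ exactIdeal.{u, v} g

/-- The ideal generated by all `[Π M] + [M]`. -/
def parityIdeal : Ideal (GrothendieckRing.{u, v} g) :=
  Ideal.span {r | ∃ M : SMod.{u, v} g,
    r = Ideal.Quotient.mk _ (gen M.shift) + Ideal.Quotient.mk _ (gen M)}

/-- The quotient `K_g` of the Grothendieck ring by the relations `[Π M] = -[M]`. -/
abbrev KRing : Type max u (v + 1) := GrothendieckRing.{u, v} g ⧸ parityIdeal.{u, v} g

variable {g} in
/-- The class `[M]` in `K_g`. -/
def KRing.cls (M : SMod.{u, v} g) : KRing.{u, v} g :=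
  Ideal.Quotient.mk _ (Ideal.Quotient.mk _ (gen M))

end Grothendieck

section Supercharacters

variable {g : Type u} [AddCommGroup g] [Module ℂ g] [LieSuperalgebra g]

instance (M : SMod.{u, v} g) : LieRingModule (part g 0) M.carrier := M.rep.evenLieRingModule

instance (M : SMod.{u, v} g) : LieModule ℂ (part g 0) M.carrier where
  smul_lie t a m := by
    change M.rep.act ((t • a : part g 0) : g) m = t • M.rep.act (a : g) m
    simp
  lie_smul t a m := by
    change M.rep.act (a : g) (t • m) = t • M.rep.act (a : g) m
    simp

/-- The homogeneous component `M_i^μ` of the weight space `M^μ`, for a nilpotent (for example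
Cartan) subalgebra `h` of `g_0` and `μ ∈ h^*`. Weight spaces are generalized weight spaces, so
that every finite-dimensional module has a weight decomposition; they are the ordinary weight
spaces whenever `h` acts diagonalizably. -/
def weightPart (h : LieSubalgebra ℂ (part g 0)) [LieRing.IsNilpotent h] (M : SMod.{u, v} g)
    (μ : Module.Dual ℂ h) (i : ZMod 2) : Submodule ℂ M.carrier :=
  (LieModule.genWeightSpace M.carrier (μ : h → ℂ)).toSubmodule ⊓ homog M.rep.par i

/-- The superdimension `dim M_0^μ - dim M_1^μ` of the weight space `M^μ`. -/
def weightSdim (h : LieSubalgebra ℂ (part g 0)) [LieRing.IsNilpotent h] (M : SMod.{u, v} g)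
    (μ : Module.Dual ℂ h) : ℤ :=
  (Module.finrank ℂ (weightPart h M μ 0) : ℤ) - Module.finrank ℂ (weightPart h M μ 1)

theorem finite_support_weightSdim (h : LieSubalgebra ℂ (part g 0)) [LieRing.IsNilpotent h]
    (M : SMod.{u, v} g) : (Function.support (weightSdim h M)).Finite := by
  have hfin := LieModule.finite_genWeightSpace_ne_bot ℂ h M.carrier
  refine (hfin.preimage (f := fun μ : Module.Dual ℂ h => (μ : h → ℂ))
    DFunLike.coe_injective.injOn).subset fun μ hμ => ?_
  intro hbot
  apply hμ
  have key : ∀ i, weightPart h M μ i = ⊥ := fun i => by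
    unfold weightPart
    rw [hbot]
    simp
  unfold weightSdim
  rw [key, key]
  simp

/-- The supercharacter `sch M = ∑_μ (dim M_0^μ - dim M_1^μ) e^μ` in the group ring `ℤ[h^*]`. -/
def sch (h : LieSubalgebra ℂ (part g 0)) [LieRing.IsNilpotent h] (M : SMod.{u, v} g) :
    AddMonoidAlgebra ℤ (Module.Dual ℂ h) :=
  .ofCoeff (Finsupp.ofSupportFinite (weightSdim h M) (finite_support_weightSdim h M))

/-- The supercharacter ring `J_g`, as the subring of `ℤ[h^*]` generated by the supercharacters of
all finite-dimensional `g`-modules. -/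
def JRing (h : LieSubalgebra ℂ (part g 0)) [LieRing.IsNilpotent h] :
    Subring (AddMonoidAlgebra ℤ (Module.Dual ℂ h)) :=
  Subring.closure (Set.range (sch.{u, v} h))

/-- The class `[M] = sch M` in `J_g`. -/
def JRing.cls (h : LieSubalgebra ℂ (part g 0)) [LieRing.IsNilpotent h] (M : SMod.{u, v} g) :
    JRing.{u, v} h :=
  ⟨sch h M, Subring.subset_closure ⟨M, rfl⟩⟩

/-- The restriction map `ℤ[h^*] → ℤ[t^*]`, `e^μ ↦ e^{μ ∘ ι}`, along a linear map `ι : t → h`. -/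
def restrictExp {h t : Type*} [AddCommGroup h] [Module ℂ h] [AddCommGroup t] [Module ℂ t]
    (ι : t →ₗ[ℂ] h) (F : AddMonoidAlgebra ℤ (Module.Dual ℂ h)) :
    AddMonoidAlgebra ℤ (Module.Dual ℂ t) :=
  F.mapDomain ι.dualMap

/-- `ι` embeds the subalgebra `t` of `g_x = g^x / [x,g]` into `h`: each `a ∈ t` is represented by
`ι a ∈ h ∩ g^x`. -/
def IsEmbeddingInto {x : SelfCommuting g} {h : LieSubalgebra ℂ (part g 0)}
    {t : LieSubalgebra ℂ (part (DSAlg x) 0)} (ι : t →ₗ[ℂ] h) : Prop :=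
  ∀ a : t, ∃ c : LinearMap.ker ((SuperRep.adjoint g).act x.elt),
    (c : g) = ((ι a : part g 0) : g) ∧
      (SuperRep.adjoint g).cls x c = ((a : part (DSAlg x) 0) : DSAlg x)

/-- The structure of a contragredient Lie superalgebra on `g` with Cartan subalgebra `h`:
simple roots `α_i`, coroots `h_i` and homogeneous Chevalley generators `e_i`, `f_i` such that
`h`, `e_i`, `f_i` generate `g`, the defining relations
`[h,h] = 0`, `[a,e_i] = α_i(a) e_i`, `[a,f_i] = -α_i(a) f_i`, `[e_i,f_j] = δ_ij h_i` hold, and no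
nonzero ideal of `g` intersects `h` trivially. The Cartan matrix is `A = (α_j(h_i))`. When `h` has
the minimal dimension `2n - rank A`, this says that `g` is the contragredient Lie superalgebra
`g(A)`; larger `h` (extra central directions) are allowed, which includes `gl(m|n)`, `m ≠ n`. -/
structure ContragredientData (h : LieSubalgebra ℂ (part g 0)) where
  n : ℕ
  parity : Fin n → ZMod 2
  e : Fin n → g
  f : Fin n → g
  root : Fin n → Module.Dual ℂ h
  coroot : Fin n → h
  e_mem : ∀ i, e i ∈ part g (parity i)
  f_mem : ∀ i, f i ∈ part g (parity i)
  root_linearIndependent : LinearIndependent ℂ root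
  coroot_linearIndependent : LinearIndependent ℂ coroot
  br_h_h : ∀ a b : h, br ((a : part g 0) : g) ((b : part g 0) : g) = 0
  br_h_e : ∀ (a : h) i, br ((a : part g 0) : g) (e i) = root i a • e i
  br_h_f : ∀ (a : h) i, br ((a : part g 0) : g) (f i) = -(root i a • f i)
  br_e_f : ∀ i j, br (e i) (f j) = if i = j then ((coroot i : part g 0) : g) else 0
  generate : ∀ S : Submodule ℂ g, (∀ a : h, ((a : part g 0) : g) ∈ S) → (∀ i, e i ∈ S) →
    (∀ i, f i ∈ S) → (∀ a ∈ S, ∀ b ∈ S, br a b ∈ S) → S = ⊤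
  ideal_eq_bot : ∀ I : Submodule ℂ g, (∀ a ∈ I, par a ∈ I) → (∀ b, ∀ a ∈ I, br b a ∈ I) →
    (∀ a : h, ((a : part g 0) : g) ∈ I → a = 0) → I = ⊥

end Supercharacters

end Super

end

/-!
The functor `DS_x` is only exact in the middle: a short exact sequence `0 → M₁ → M₂ → M₃ → 0` gives
an exact triangle `(M₁)_x → (M₂)_x → (M₃)_x → Π (M₁)_x`, so that `[M_x]` is additive in `M` as soon
as `[Π M] = -[M]`. The module `M`, a complex with differential `x`, is a deformation retract of its
cohomology `M_x`; tensoring retracts gives `(M ⊗ N)_x ≅ M_x ⊗ N_x`.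

Distinct exponentials being linearly independent, `sch_h M` carries the same information as the
supertraces of all powers of the elements of `h` on `M`. Since `exp (ad g_0)` moves `h` over an
open subset of `g_0`, the vanishing of the invariant polynomials `a ↦ str_M (a ^ k)` on `h` implies
their vanishing on `g_0`. Finally an even `c ∈ g^x` has the same supertrace on `M` as on `M_x`, by
the homotopy between `M` and `M_x`. Hence `sch_h M` determines `sch_t M_x`.
-/

noncomputable section

namespace Super

open LieSuperalgebra TensorProduct

variable {g : Type u} [AddCommGroup g] [Module ℂ g] [LieSuperalgebra g]

/-! ### Stable subspaces and the universal property of `K_g` -/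

namespace SuperRep

variable {V : Type v} [AddCommGroup V] [Module ℂ V] {W : Type v} [AddCommGroup W] [Module ℂ W]

/-- A subrepresentation, encoded as a subspace stable under the grading involution (that is, a
graded subspace) and under the action of `g`. -/
structure IsStable (R : SuperRep g V) (U : Submodule ℂ V) : Prop where
  par_mem : ∀ m ∈ U, R.par m ∈ U
  act_mem : ∀ a, ∀ m ∈ U, R.act a m ∈ U

/-- The restriction of a representation to a stable subspace. -/
def sub (R : SuperRep g V) {U : Submodule ℂ V} (hU : R.IsStable U) : SuperRep g U :=
  .mk' (R.par.restrict hU.par_mem) (fun m => Subtype.ext (R.par_par m))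
    { toFun := fun a => (R.act a).restrict (hU.act_mem a)
      map_add' := fun a b => by ext m; simp
      map_smul' := fun t a => by ext m; simp }
    (fun a m => Subtype.ext (R.par_act a m))
    (fun ha hb m => Subtype.ext (R.act_br ha hb m))

/-- The representation on the quotient by a stable subspace. -/
def quot (R : SuperRep g V) {U : Submodule ℂ V} (hU : R.IsStable U) : SuperRep g (V ⧸ U) :=
  .mk' (U.mapQ U R.par hU.par_mem)
    (U.mkQ_surjective.forall.mpr fun m => congrArg U.mkQ (R.par_par m))
    { toFun := fun a => U.mapQ U (R.act a) (hU.act_mem a)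
      map_add' := fun a b => by ext m; simp
      map_smul' := fun t a => by ext m; simp }
    (fun a => U.mkQ_surjective.forall.mpr fun m => congrArg U.mkQ (R.par_act a m))
    (fun ha hb => U.mkQ_surjective.forall.mpr fun m => congrArg U.mkQ (R.act_br ha hb m))

/-- The direct sum of two representations. -/
def prod (R : SuperRep g V) (S : SuperRep g W) : SuperRep g (V × W) :=
  .mk' (R.par.prodMap S.par) (fun m => Prod.ext (R.par_par m.1) (S.par_par m.2))
    { toFun := fun a => (R.act a).prodMap (S.act a)
      map_add' := fun a b => by ext m <;> simp
      map_smul' := fun t a => by ext m <;> simp }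
    (fun a m => Prod.ext (R.par_act a m.1) (S.par_act a m.2))
    (fun ha hb m => Prod.ext (R.act_br ha hb m.1) (S.act_br ha hb m.2))

namespace IsHom

variable {R : SuperRep g V} {S : SuperRep g W} {f : V →ₗ[ℂ] W}

theorem isStable_ker (hf : IsHom R S f) : R.IsStable (LinearMap.ker f) where
  par_mem m hm := by rw [LinearMap.mem_ker] at *; rw [hf.map_par, hm, map_zero]
  act_mem a m hm := by rw [LinearMap.mem_ker] at *; rw [hf.map_act, hm, map_zero]

theorem isStable_range (hf : IsHom R S f) : S.IsStable (LinearMap.range f) where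
  par_mem := by rintro _ ⟨m, rfl⟩; exact ⟨_, hf.map_par m⟩
  act_mem := by rintro a _ ⟨m, rfl⟩; exact ⟨_, hf.map_act a m⟩

end IsHom

end SuperRep

namespace SMod

/-- A stable subspace of a module, as a module. -/
def sub (M : SMod.{u, v} g) {U : Submodule ℂ M.carrier} (hU : M.rep.IsStable U) :
    SMod.{u, v} g where
  carrier := U
  rep := M.rep.sub hU

/-- The quotient of a module by a stable subspace. -/
def quot (M : SMod.{u, v} g) {U : Submodule ℂ M.carrier} (hU : M.rep.IsStable U) :
    SMod.{u, v} g where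
  carrier := M.carrier ⧸ U
  rep := M.rep.quot hU

/-- The direct sum of two modules. -/
def prod (M N : SMod.{u, v} g) : SMod.{u, v} g where
  carrier := M.carrier × N.carrier
  rep := M.rep.prod N.rep

theorem isShortExact_sub_quot (M : SMod.{u, v} g) {U : Submodule ℂ M.carrier}
    (hU : M.rep.IsStable U) : IsShortExact (M.sub hU) M (M.quot hU) :=
  ⟨U.subtype, U.mkQ, ⟨fun _ => rfl, fun _ _ => rfl⟩, ⟨fun _ => rfl, fun _ _ => rfl⟩,
    U.injective_subtype, LinearMap.exact_subtype_mkQ U, U.mkQ_surjective⟩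

theorem isShortExact_ker_range {M N : SMod.{u, v} g} {f : M.carrier →ₗ[ℂ] N.carrier}
    (hf : SuperRep.IsHom M.rep N.rep f) :
    IsShortExact (M.sub hf.isStable_ker) M (N.sub hf.isStable_range) := by
  have hex : Function.Exact (LinearMap.ker f).subtype f.rangeRestrict := by
    rw [LinearMap.exact_iff, Submodule.range_subtype, LinearMap.ker_rangeRestrict]
  exact ⟨(LinearMap.ker f).subtype, f.rangeRestrict, ⟨fun _ => rfl, fun _ _ => rfl⟩,
    ⟨fun m => Subtype.ext (hf.map_par m), fun a m => Subtype.ext (hf.map_act a m)⟩,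
    Submodule.injective_subtype _, hex, f.surjective_rangeRestrict⟩

theorem Iso.isShortExact_prod {M M' : SMod.{u, v} g} (h : Iso M M') (N : SMod.{u, v} g) :
    IsShortExact M (M'.prod N) N := by
  obtain ⟨e, he⟩ := h
  refine ⟨LinearMap.inl ℂ M'.carrier N.carrier ∘ₗ e, LinearMap.snd ℂ M'.carrier N.carrier,
    ⟨fun m => Prod.ext (he.map_par m) (map_zero N.rep.par).symm,
      fun a m => Prod.ext (he.map_act a m) (map_zero (N.rep.act a)).symm⟩,
    ⟨fun _ => rfl, fun _ _ => rfl⟩, LinearMap.inl_injective.comp e.injective,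
    LinearMap.exact_iff.mpr ?_, LinearMap.snd_surjective⟩
  exact (LinearMap.range_inl ..).symm.trans (e.range_comp _).symm

/-- A ring-valued invariant of `g`-modules that is additive on short exact sequences, changes sign
under the parity shift and is multiplicative on tensor products. The class in `K_g` is the
universal one. -/
structure IsSuperEulerChar {A : Type*} [CommRing A] (φ : SMod.{u, v} g → A) : Prop where
  map_exact : ∀ {M₁ M₂ M₃}, IsShortExact M₁ M₂ M₃ → φ M₂ = φ M₁ + φ M₃
  map_shift : ∀ M, φ M.shift = -φ M
  map_unit : φ (unit g) = 1
  map_tensor : ∀ M N, φ (M.tensor N) = φ M * φ N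

namespace IsSuperEulerChar

variable {A : Type*} [CommRing A] {φ : SMod.{u, v} g → A}

theorem map_prod (hφ : IsSuperEulerChar φ) (M N : SMod.{u, v} g) :
    φ (M.prod N) = φ M + φ N :=
  hφ.map_exact ((Iso.refl M).isShortExact_prod N)

theorem map_iso (hφ : IsSuperEulerChar φ) {M N : SMod.{u, v} g} (h : Iso M N) : φ M = φ N :=
  add_right_cancel ((hφ.map_exact (h.isShortExact_prod N)).symm.trans (hφ.map_prod N N))

/-- The ring homomorphism from the free ring on isomorphism classes given by `φ`. -/
def freeLift (hφ : IsSuperEulerChar φ) : FreeAbelianGroup (IsoClass.{u, v} g) →+* A :=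
  FreeAbelianGroup.liftMonoid
    { toFun := Quotient.lift φ fun _ _ => hφ.map_iso
      map_one' := hφ.map_unit
      map_mul' := by rintro ⟨M⟩ ⟨N⟩; exact hφ.map_tensor M N }

theorem freeLift_gen (hφ : IsSuperEulerChar φ) (M : SMod.{u, v} g) :
    hφ.freeLift (gen M) = φ M :=
  FreeAbelianGroup.lift_apply_of _ _

theorem freeLift_eq_zero (hφ : IsSuperEulerChar φ) :
    ∀ r ∈ exactIdeal.{u, v} g, hφ.freeLift r = 0 := by
  suffices exactIdeal.{u, v} g ≤ RingHom.ker hφ.freeLift from fun r hr => this hr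
  change AddSubgroup.closure (exactRelations.{u, v} g) ≤ hφ.freeLift.toAddMonoidHom.ker
  rw [AddSubgroup.closure_le]
  rintro _ ⟨M₁, M₂, M₃, h, rfl⟩
  change hφ.freeLift (gen M₁ - gen M₂ + gen M₃) = 0
  rw [map_add, map_sub, freeLift_gen, freeLift_gen, freeLift_gen, hφ.map_exact h]
  ring

end IsSuperEulerChar

end SMod

namespace KRing

theorem isSuperEulerChar_cls : SMod.IsSuperEulerChar (cls.{u, v} (g := g)) where
  map_exact {M₁ M₂ M₃} h := by
    have h₀ : Ideal.Quotient.mk (exactIdeal.{u, v} g) (gen M₁ - gen M₂ + gen M₃) = 0 :=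
      Ideal.Quotient.eq_zero_iff_mem.mpr (AddSubgroup.subset_closure ⟨M₁, M₂, M₃, h, rfl⟩)
    have h₁ : cls M₁ - cls M₂ + cls M₃ = 0 :=
      (congrArg (Ideal.Quotient.mk (parityIdeal.{u, v} g)) h₀).trans (map_zero _)
    linear_combination -h₁
  map_shift M := eq_neg_of_add_eq_zero_left <|
    Ideal.Quotient.eq_zero_iff_mem.mpr (Ideal.subset_span ⟨M, rfl⟩)
  map_unit := rfl
  map_tensor _ _ := rfl

/-- The ring homomorphism `K_g → A` given by the universal property of `K_g`. -/
def lift {A : Type*} [CommRing A] {φ : SMod.{u, v} g → A} (hφ : SMod.IsSuperEulerChar φ) :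
    KRing.{u, v} g →+* A :=
  Ideal.Quotient.lift _ (Ideal.Quotient.lift _ hφ.freeLift hφ.freeLift_eq_zero) <| by
    suffices parityIdeal.{u, v} g ≤
        RingHom.ker (Ideal.Quotient.lift _ hφ.freeLift hφ.freeLift_eq_zero) from
      fun r hr => this hr
    refine Ideal.span_le.mpr ?_
    rintro _ ⟨M, rfl⟩
    rw [SetLike.mem_coe, RingHom.mem_ker, map_add, Ideal.Quotient.lift_mk, Ideal.Quotient.lift_mk,
      hφ.freeLift_gen, hφ.freeLift_gen, hφ.map_shift, neg_add_cancel]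

theorem lift_cls {A : Type*} [CommRing A] {φ : SMod.{u, v} g → A} (hφ : SMod.IsSuperEulerChar φ)
    (M : SMod.{u, v} g) : lift hφ (cls M) = φ M :=
  hφ.freeLift_gen M

/-- Negatives are classes of modules because of the parity shift, and sums because of direct
sums. -/
theorem cls_surjective : Function.Surjective (cls.{u, v} (g := g)) := by
  let π : FreeAbelianGroup (IsoClass.{u, v} g) →+* KRing.{u, v} g :=
    (Ideal.Quotient.mk (parityIdeal g)).comp (Ideal.Quotient.mk (exactIdeal g))
  have hπ : Function.Surjective π :=
    Ideal.Quotient.mk_surjective.comp Ideal.Quotient.mk_surjective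
  intro c
  obtain ⟨r, rfl⟩ := hπ c
  induction r using FreeAbelianGroup.induction_on with
  | zero => exact ⟨(SMod.unit g).prod (SMod.unit g).shift, by
      rw [isSuperEulerChar_cls.map_prod, isSuperEulerChar_cls.map_shift, add_neg_cancel, map_zero]⟩
  | of c =>
    obtain ⟨M⟩ := c
    exact ⟨M, rfl⟩
  | neg c hc =>
    obtain ⟨M, hM⟩ := hc
    exact ⟨M.shift, by rw [isSuperEulerChar_cls.map_shift, hM, map_neg]⟩
  | add r s hr hs =>
    obtain ⟨M, hM⟩ := hr
    obtain ⟨N, hN⟩ := hs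
    exact ⟨M.prod N, by rw [isSuperEulerChar_cls.map_prod, hM, hN, map_add]⟩

/-- The isomorphism `hconn` closes an exact triangle `A → B → C → Π A`. -/
theorem cls_eq_add_of_exact_triangle {A B C : SMod.{u, v} g} {f : A.carrier →ₗ[ℂ] B.carrier}
    {p : B.carrier →ₗ[ℂ] C.carrier} (hf : SuperRep.IsHom A.rep B.rep f)
    (hp : SuperRep.IsHom B.rep C.rep p) (hex : LinearMap.ker p = LinearMap.range f)
    (hconn : SMod.Iso (C.quot hp.isStable_range) (A.sub hf.isStable_ker).shift) :
    cls B = cls A + cls C := by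
  have hχ := isSuperEulerChar_cls.{u, v} (g := g)
  have hB : cls (B.sub hp.isStable_ker) = cls (B.sub hf.isStable_range) := by congr
  linear_combination hχ.map_exact (SMod.isShortExact_ker_range hp) + hB
    - hχ.map_exact (SMod.isShortExact_ker_range hf)
    - hχ.map_exact (C.isShortExact_sub_quot hp.isStable_range)
    - hχ.map_iso hconn - hχ.map_shift (A.sub hf.isStable_ker)

end KRing

/-! ### The exact triangle of a short exact sequence -/

namespace SuperRep

section

variable {V W : Type v} [AddCommGroup V] [Module ℂ V] [AddCommGroup W] [Module ℂ W]

theorem act_x_act_x (R : SuperRep g V) (x : SelfCommuting g) (m : V) :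
    R.act x.elt (R.act x.elt m) = 0 := by
  have h := R.act_br x.odd x.odd m
  rw [x.sq, mul_one, sgn_one, neg_one_smul, sub_neg_eq_add, map_zero, LinearMap.zero_apply,
    ← two_smul ℂ] at h
  exact (smul_eq_zero.mp h.symm).resolve_left two_ne_zero

theorem cls_eq_cls (R : SuperRep g V) (x : SelfCommuting g) {m n : LinearMap.ker (R.act x.elt)} :
    R.cls x m = R.cls x n ↔ ∃ k, R.act x.elt k = m - n := by
  rw [← sub_eq_zero, ← map_sub, cls_eq_zero, Submodule.coe_sub]

namespace IsHom

variable {R : SuperRep g V} {S : SuperRep g W} {f : V →ₗ[ℂ] W}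

theorem act_x_eq_zero (hf : IsHom R S f) {x : SelfCommuting g} {m : V} (hm : R.act x.elt m = 0) :
    S.act x.elt (f m) = 0 := by
  rw [← hf.map_act, hm, map_zero]

/-- The map `V_x → W_x` on cohomology induced by a homomorphism `V → W`. -/
def cohMap (hf : IsHom R S f) (x : SelfCommuting g) : R.Coh x →ₗ[ℂ] S.Coh x :=
  Submodule.mapQ _ _ (f.restrict fun _ hm => hf.act_x_eq_zero hm) <| by
    rintro ⟨_, _⟩ ⟨n, rfl⟩
    exact ⟨f n, (hf.map_act _ _).symm⟩

theorem cohMap_cls (hf : IsHom R S f) (x : SelfCommuting g) (m : LinearMap.ker (R.act x.elt)) :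
    hf.cohMap x (R.cls x m) = S.cls x ⟨f m, hf.act_x_eq_zero m.2⟩ := rfl

theorem ds (hf : IsHom R S f) (x : SelfCommuting g) :
    IsHom (R.ds x) (S.ds x) (hf.cohMap x) where
  map_par := (R.cls_surjective x).forall.mpr fun m =>
    congrArg (S.cls x) (Subtype.ext (hf.map_par m))
  map_act := ((adjoint g).cls_surjective x).forall.mpr fun a =>
    (R.cls_surjective x).forall.mpr fun m => congrArg (S.cls x) (Subtype.ext (hf.map_act a m))

end IsHom

end

/-- `f` and `p` are homomorphisms of representations forming a short exact sequence
`0 → V₁ → V₂ → V₃ → 0`. -/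
structure IsShortExact {V₁ V₂ V₃ : Type v} [AddCommGroup V₁] [Module ℂ V₁] [AddCommGroup V₂]
    [Module ℂ V₂] [AddCommGroup V₃] [Module ℂ V₃] (R₁ : SuperRep g V₁) (R₂ : SuperRep g V₂)
    (R₃ : SuperRep g V₃) (f : V₁ →ₗ[ℂ] V₂) (p : V₂ →ₗ[ℂ] V₃) : Prop where
  left : IsHom R₁ R₂ f
  right : IsHom R₂ R₃ p
  injective : Function.Injective f
  exact : Function.Exact f p
  surjective : Function.Surjective p

namespace IsShortExact

variable {V₁ V₂ V₃ : Type v} [AddCommGroup V₁] [Module ℂ V₁] [AddCommGroup V₂] [Module ℂ V₂]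
  [AddCommGroup V₃] [Module ℂ V₃] {R₁ : SuperRep g V₁} {R₂ : SuperRep g V₂}
  {R₃ : SuperRep g V₃} {f : V₁ →ₗ[ℂ] V₂} {p : V₂ →ₗ[ℂ] V₃}

theorem ker_cohMap_eq_range (h : IsShortExact R₁ R₂ R₃ f p) (x : SelfCommuting g) :
    LinearMap.ker (h.right.cohMap x) = LinearMap.range (h.left.cohMap x) := by
  refine le_antisymm (fun m hm => ?_) ?_
  · obtain ⟨⟨m, hxm⟩, rfl⟩ := R₂.cls_surjective x m
    rw [LinearMap.mem_ker, h.right.cohMap_cls, R₃.cls_eq_zero] at hm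
    obtain ⟨n, hn⟩ := hm
    obtain ⟨n, rfl⟩ := h.surjective n
    obtain ⟨l, hl⟩ := (h.exact (m - R₂.act x.elt n)).mp (by
      rw [map_sub, h.right.map_act, hn, sub_self])
    have hxl : R₁.act x.elt l = 0 := h.injective (by
      rw [h.left.map_act, hl, map_sub, R₂.act_x_act_x, LinearMap.mem_ker.mp hxm, sub_zero,
        map_zero])
    refine ⟨R₁.cls x ⟨l, hxl⟩, ?_⟩
    rw [h.left.cohMap_cls, R₂.cls_eq_cls]
    exact ⟨-n, by simp only [map_neg, hl, sub_sub_cancel_left]⟩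
  · rintro _ ⟨l, rfl⟩
    obtain ⟨l, rfl⟩ := R₁.cls_surjective x l
    exact (R₃.cls_eq_zero x).mpr ⟨0, (map_zero _).trans (h.exact.apply_apply_eq_zero _).symm⟩

/-- The graph of the connecting homomorphism at the level of cochains: the pairs `(q, l)` with
`x θ(q) = f(l)`, where `θ` is the grading involution. The connecting homomorphism, which is odd,
maps the class of `p(q)` to the class of `l`; the involution `θ` makes it commute with `g_x`. -/
def zigzags (_ : IsShortExact R₁ R₂ R₃ f p) (x : SelfCommuting g) : Submodule ℂ (V₂ × V₁) :=
  LinearMap.eqLocus ((R₂.act x.elt ∘ₗ R₂.par) ∘ₗ LinearMap.fst ℂ V₂ V₁)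
    (f ∘ₗ LinearMap.snd ℂ V₂ V₁)

variable (h : IsShortExact R₁ R₂ R₃ f p) {x : SelfCommuting g}
include h

theorem act_x_source {q : V₂} {l : V₁} (hz : R₂.act x.elt (R₂.par q) = f l) :
    R₃.act x.elt (p q) = 0 := by
  rw [← R₃.par_par (p q), ← h.right.map_par]
  refine R₃.par_mem_ker x ?_
  rw [← h.right.map_act, hz, h.exact.apply_apply_eq_zero]

theorem act_x_target {q : V₂} {l : V₁} (hz : R₂.act x.elt (R₂.par q) = f l) :
    R₁.act x.elt l = 0 :=
  h.injective (by rw [h.left.map_act, ← hz, R₂.act_x_act_x, map_zero])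

variable (x)

/-- The class of `p(q)` for a zigzag `(q, l)`. -/
def source : h.zigzags x →ₗ[ℂ] R₃.Coh x :=
  R₃.cls x ∘ₗ (p ∘ₗ LinearMap.fst ℂ V₂ V₁).restrict fun _ hz => h.act_x_source hz

/-- The class of `l` for a zigzag `(q, l)`. -/
def target : h.zigzags x →ₗ[ℂ] R₁.Coh x :=
  R₁.cls x ∘ₗ (LinearMap.snd ℂ V₂ V₁).restrict fun _ hz => h.act_x_target hz

theorem source_surjective : Function.Surjective (h.source x) := fun c => by
  obtain ⟨⟨n, hn⟩, rfl⟩ := R₃.cls_surjective x c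
  obtain ⟨q, rfl⟩ := h.surjective n
  obtain ⟨l, hl⟩ := (h.exact (R₂.act x.elt (R₂.par q))).mp (by
    rw [h.right.map_act, h.right.map_par, R₃.par_mem_ker x hn])
  exact ⟨⟨(q, l), hl.symm⟩, rfl⟩

theorem range_target : LinearMap.range (h.target x) = LinearMap.ker (h.left.cohMap x) := by
  refine le_antisymm ?_ fun c hc => ?_
  · rintro _ ⟨⟨⟨q, l⟩, hz⟩, rfl⟩
    exact (R₂.cls_eq_zero x).mpr ⟨_, hz⟩
  · obtain ⟨l, rfl⟩ := R₁.cls_surjective x c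
    obtain ⟨q, hq⟩ := (R₂.cls_eq_zero x).mp hc
    exact ⟨⟨(R₂.par q, l), (congrArg _ (R₂.par_par q)).trans hq⟩, rfl⟩

variable {x} in
theorem target_eq_zero_iff (z : h.zigzags x) :
    h.target x z = 0 ↔ h.source x z ∈ LinearMap.range (h.right.cohMap x) := by
  obtain ⟨⟨q, l⟩, hz⟩ := z
  have hz' : R₂.act x.elt (R₂.par q) = f l := hz
  constructor
  · intro hl
    obtain ⟨m, hm : R₁.act x.elt m = l⟩ := (R₁.cls_eq_zero x).mp hl
    have hq : R₂.act x.elt (q - R₂.par (f m)) = 0 := by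
      rw [← R₂.par_par (q - R₂.par (f m))]
      refine R₂.par_mem_ker x ?_
      rw [map_sub, R₂.par_par, map_sub, hz', ← hm, h.left.map_act, sub_self]
    refine ⟨R₂.cls x ⟨_, hq⟩, congrArg (R₃.cls x) (Subtype.ext ?_)⟩
    change p (q - R₂.par (f m)) = p q
    rw [map_sub, ← h.left.map_par, h.exact.apply_apply_eq_zero, sub_zero]
  · rintro ⟨c, hc⟩
    obtain ⟨⟨k, hk⟩, rfl⟩ := R₂.cls_surjective x c
    obtain ⟨n, hn⟩ := (R₃.cls_eq_cls x).mp hc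
    obtain ⟨n, rfl⟩ := h.surjective n
    obtain ⟨m, hm⟩ := (h.exact (k - q - R₂.act x.elt n)).mp (by
      rw [map_sub, map_sub, h.right.map_act, hn]; exact sub_self _)
    refine (R₁.cls_eq_zero x).mpr ⟨-R₁.par m, h.injective ?_⟩
    change f (R₁.act x.elt (-R₁.par m)) = f l
    rw [map_neg, map_neg, h.left.map_act, h.left.map_par, hm, ← hz', map_sub, map_sub, map_sub,
      map_sub, R₂.par_mem_ker x hk, R₂.par_x, map_neg, R₂.act_x_act_x]
    abel

theorem exists_zigzag_par (z : h.zigzags x) : ∃ z' : h.zigzags x,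
    h.source x z' = (R₃.ds x).par (h.source x z) ∧
      h.target x z' = -(R₁.ds x).par (h.target x z) := by
  obtain ⟨⟨q, l⟩, hz⟩ := z
  have hz' : R₂.act x.elt (R₂.par q) = f l := hz
  refine ⟨⟨(R₂.par q, -R₁.par l), ?_⟩, congrArg (R₃.cls x) (Subtype.ext (h.right.map_par q)),
    map_neg (R₁.cls x) ⟨R₁.par l, R₁.par_mem_ker x (h.act_x_target hz)⟩⟩
  change R₂.act x.elt (R₂.par (R₂.par q)) = f (-R₁.par l)
  rw [map_neg, h.left.map_par, ← hz', R₂.par_x, neg_neg]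

theorem exists_zigzag_act (c : DSAlg x) (z : h.zigzags x) : ∃ z' : h.zigzags x,
    h.source x z' = (R₃.ds x).act c (h.source x z) ∧
      h.target x z' = (R₁.ds x).act c (h.target x z) := by
  obtain ⟨⟨q, l⟩, hz⟩ := z
  obtain ⟨c, rfl⟩ := (adjoint g).cls_surjective x c
  have hz' : R₂.act x.elt (R₂.par q) = f l := hz
  refine ⟨⟨(R₂.act c q, R₁.act c l), ?_⟩,
    congrArg (R₃.cls x) (Subtype.ext (h.right.map_act c q)), rfl⟩
  change R₂.act x.elt (R₂.par (R₂.act c q)) = f (R₁.act c l)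
  rw [h.left.map_act, ← hz', R₂.par_act, R₂.act_x_comm x c.2]

end IsShortExact

end SuperRep

namespace SMod

theorem Iso.of_correspondence {M N : SMod.{u, v} g} {Z : Type*} [AddCommGroup Z] [Module ℂ Z]
    (a : Z →ₗ[ℂ] M.carrier) (b : Z →ₗ[ℂ] N.carrier) (ha : Function.Surjective a)
    (hb : Function.Surjective b) (hab : ∀ z, a z = 0 ↔ b z = 0)
    (hpar : ∀ z, ∃ z', a z' = M.rep.par (a z) ∧ b z' = N.rep.par (b z))
    (hact : ∀ c z, ∃ z', a z' = M.rep.act c (a z) ∧ b z' = N.rep.act c (b z)) : Iso M N := by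
  have hker : LinearMap.ker a = LinearMap.ker b := Submodule.ext hab
  let e : M.carrier ≃ₗ[ℂ] N.carrier := (a.quotKerEquivOfSurjective ha).symm ≪≫ₗ
    Submodule.quotEquivOfEq _ _ hker ≪≫ₗ b.quotKerEquivOfSurjective hb
  have he (z : Z) : e (a z) = b z := by
    have : (a.quotKerEquivOfSurjective ha).symm (a z) = Submodule.Quotient.mk z := by
      rw [LinearEquiv.symm_apply_eq]; rfl
    simp only [e, LinearEquiv.trans_apply, this]
    rfl
  refine ⟨e, ha.forall.mpr fun z => ?_, fun c => ha.forall.mpr fun z => ?_⟩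
  · obtain ⟨z', hz, hz'⟩ := hpar z
    rw [← hz, LinearEquiv.coe_coe, he, he, hz']
  · obtain ⟨z', hz, hz'⟩ := hact c z
    rw [← hz, LinearEquiv.coe_coe, he, he, hz']

variable {M₁ M₂ M₃ : SMod.{u, v} g} {f : M₁.carrier →ₗ[ℂ] M₂.carrier}
  {p : M₂.carrier →ₗ[ℂ] M₃.carrier}

theorem iso_connecting (h : SuperRep.IsShortExact M₁.rep M₂.rep M₃.rep f p)
    (x : SelfCommuting g) :
    Iso ((M₃.DS x).quot (h.right.ds x).isStable_range)
      ((M₁.DS x).sub (h.left.ds x).isStable_ker).shift := by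
  have hmem (z : h.zigzags x) : h.target x z ∈ LinearMap.ker (h.left.cohMap x) :=
    (h.range_target x).le ⟨z, rfl⟩
  refine .of_correspondence ((LinearMap.range (h.right.cohMap x)).mkQ ∘ₗ h.source x)
    ((h.target x).codRestrict _ hmem) ?_ ?_ (fun z => ?_) (fun z => ?_) (fun c z => ?_)
  · exact (Submodule.mkQ_surjective _).comp (h.source_surjective x)
  · rintro ⟨c, hc⟩
    obtain ⟨z, rfl⟩ := (h.range_target x).ge hc
    exact ⟨z, rfl⟩
  · exact (Submodule.Quotient.mk_eq_zero _).trans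
      ((h.target_eq_zero_iff z).symm.trans (Submodule.mk_eq_zero _ (hmem z)).symm)
  · obtain ⟨z', hs, ht⟩ := h.exists_zigzag_par x z
    exact ⟨z', congrArg _ hs, Subtype.ext ht⟩
  · obtain ⟨z', hs, ht⟩ := h.exists_zigzag_act x c z
    exact ⟨z', congrArg _ hs, Subtype.ext ht⟩

theorem shift_DS (M : SMod.{u, v} g) (x : SelfCommuting g) :
    Iso (M.shift.DS x) (M.DS x).shift :=
  ⟨LinearEquiv.refl ℂ (M.rep.Coh x), (M.rep.cls_surjective x).forall.mpr fun m =>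
    map_neg (M.rep.cls x) ⟨M.rep.par m, M.rep.par_mem_ker x m.2⟩, fun _ _ => rfl⟩

theorem unit_DS (x : SelfCommuting g) :
    Iso ((unit.{u, v} g).DS x) (unit.{u, v} (DSAlg x)) := by
  let R := SuperRep.trivial.{u, v} g
  refine .of_correspondence (R.cls x) (LinearMap.ker (R.act x.elt)).subtype (R.cls_surjective x)
    (fun m => ⟨⟨m, rfl⟩, rfl⟩) (fun m => ?_) (fun m => ⟨m, rfl, rfl⟩) (fun c m => ⟨0, ?_, rfl⟩)
  · exact (R.cls_eq_zero x).trans ⟨fun ⟨_, hn⟩ => hn.symm, fun hm => ⟨0, hm.symm⟩⟩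
  · obtain ⟨c, rfl⟩ := (SuperRep.adjoint g).cls_surjective x c
    rfl

end SMod

theorem KRing.cls_DS_eq_add {M₁ M₂ M₃ : SMod.{u, v} g} (h : SMod.IsShortExact M₁ M₂ M₃)
    (x : SelfCommuting g) : cls (M₂.DS x) = cls (M₁.DS x) + cls (M₃.DS x) := by
  obtain ⟨f, p, hf, hp, hinj, hex, hsurj⟩ := h
  have h : SuperRep.IsShortExact M₁.rep M₂.rep M₃.rep f p := ⟨hf, hp, hinj, hex, hsurj⟩
  exact cls_eq_add_of_exact_triangle (hf.ds x) (hp.ds x) (h.ker_cohMap_eq_range x)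
    (SMod.iso_connecting h x)

/-! ### The Künneth isomorphism -/

section

variable {V : Type*} [AddCommGroup V] [Module ℂ V]

theorem exists_pseudoInverse (d : V →ₗ[ℂ] V) : ∃ s : V →ₗ[ℂ] V, ∀ m, d (s (d m)) = d m := by
  obtain ⟨s₀, hs₀⟩ := d.rangeRestrict.exists_rightInverse_of_surjective d.range_rangeRestrict
  obtain ⟨s, hs⟩ := s₀.exists_extend
  refine ⟨s, fun m => ?_⟩
  have hsm : s (d m) = s₀ (d.rangeRestrict m) := LinearMap.congr_fun hs (d.rangeRestrict m)
  rw [hsm]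
  exact congrArg Subtype.val (LinearMap.congr_fun hs₀ (d.rangeRestrict m))

end

namespace SuperRep

section

variable {V : Type v} [AddCommGroup V] [Module ℂ V]

theorem x_par (R : SuperRep g V) (x : SelfCommuting g) (m : V) :
    R.act x.elt (R.par m) = -R.par (R.act x.elt m) := by
  rw [R.par_x, neg_neg]

theorem exists_odd_pseudoInverse (R : SuperRep g V) (x : SelfCommuting g) :
    ∃ s : V →ₗ[ℂ] V, (∀ m, R.act x.elt (s (R.act x.elt m)) = R.act x.elt m) ∧
      ∀ m, s (R.par m) = -R.par (s m) := by
  obtain ⟨s, hs⟩ := exists_pseudoInverse (R.act x.elt)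
  refine ⟨(1 / 2 : ℂ) • (s - R.par ∘ₗ s ∘ₗ R.par), fun m => ?_, fun m => ?_⟩
  · have hconj : R.act x.elt (R.par (s (R.par (R.act x.elt m)))) = -R.act x.elt m := by
      rw [R.x_par, R.par_x x m, map_neg, map_neg, hs, map_neg, neg_neg, R.par_x, R.par_par]
    simp only [LinearMap.smul_apply, LinearMap.sub_apply, LinearMap.comp_apply, map_smul, map_sub,
      hs, hconj]
    module
  · simp only [LinearMap.smul_apply, LinearMap.sub_apply, LinearMap.comp_apply, map_smul, map_sub,
      R.par_par]
    module

/-- A realization of the cohomology `V_x` as a deformation retract of the complex `V` with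
differential `x`, the contracting homotopy being odd. -/
structure CohRetract (R : SuperRep g V) (x : SelfCommuting g) where
  incl : R.Coh x →ₗ[ℂ] V
  proj : V →ₗ[ℂ] R.Coh x
  htpy : V →ₗ[ℂ] V
  act_incl : ∀ c, R.act x.elt (incl c) = 0
  proj_coe : ∀ m : LinearMap.ker (R.act x.elt), proj m = R.cls x m
  incl_proj : ∀ m, incl (proj m) = m - R.act x.elt (htpy m) - htpy (R.act x.elt m)
  htpy_par : ∀ m, htpy (R.par m) = -R.par (htpy m)

/-- The homotopy `s + P s`, where `d s d = d` and `P = 1 - d s - s d`, makes the retraction onto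
the cohomology equal to `P²`, which depends on a cocycle only through its class. -/
theorem nonempty_cohRetract (R : SuperRep g V) (x : SelfCommuting g) :
    Nonempty (CohRetract R x) := by
  obtain ⟨s, hs, hpar⟩ := R.exists_odd_pseudoInverse x
  let P : V →ₗ[ℂ] V := .id - R.act x.elt ∘ₗ s - s ∘ₗ R.act x.elt
  have hP (m : V) : P m = m - R.act x.elt (s m) - s (R.act x.elt m) := rfl
  have act_P (m : V) : R.act x.elt (P m) = 0 := by
    simp only [hP, map_sub, hs, act_x_act_x]
    abel
  have P_act (m : V) : P (R.act x.elt m) = 0 := by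
    simp only [hP, hs, act_x_act_x, map_zero, sub_self]
  have P_par (m : V) : P (R.par m) = R.par (P m) := by
    simp only [hP, hpar, R.x_par, map_neg, neg_neg, map_sub]
  let incl : R.Coh x →ₗ[ℂ] V :=
    Submodule.liftQ _ (P ∘ₗ (LinearMap.ker (R.act x.elt)).subtype) <| by
      rintro ⟨_, _⟩ ⟨n, rfl⟩
      exact P_act n
  refine ⟨⟨incl, R.cls x ∘ₗ P.codRestrict _ act_P, s + P ∘ₗ s, ?_, ?_, fun m => ?_, fun m => ?_⟩⟩
  · exact (R.cls_surjective x).forall.mpr fun m => act_P m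
  · rintro ⟨m, hm⟩
    refine (R.cls_eq_cls x).mpr ⟨-s m, ?_⟩
    change R.act x.elt (-s m) = P m - m
    rw [hP, LinearMap.mem_ker.mp hm, map_zero, map_neg]
    abel
  · change P (P m) = m - R.act x.elt (s m + P (s m)) - (s (R.act x.elt m) + P (s (R.act x.elt m)))
    rw [hP m, map_sub, map_sub, P_act, map_add, act_P, hP m]
    abel
  · simp only [LinearMap.add_apply, LinearMap.comp_apply, hpar, map_neg, P_par, map_add, neg_add]

namespace CohRetract

variable {R : SuperRep g V} {x : SelfCommuting g} (D : CohRetract R x)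
include D

theorem proj_act (m : V) : D.proj (R.act x.elt m) = 0 :=
  (D.proj_coe ⟨_, R.act_x_act_x x m⟩).trans ((R.cls_eq_zero x).mpr ⟨m, rfl⟩)

theorem proj_incl (c : R.Coh x) : D.proj (D.incl c) = c := by
  obtain ⟨m, rfl⟩ := R.cls_surjective x c
  rw [← D.proj_coe, D.incl_proj, map_sub, map_sub, D.proj_act, LinearMap.mem_ker.mp m.2, map_zero,
    map_zero, sub_zero, sub_zero]

theorem incl_proj_par (m : V) : D.incl (D.proj (R.par m)) = R.par (D.incl (D.proj m)) := by
  simp only [D.incl_proj, D.htpy_par, R.x_par, map_neg, neg_neg, map_sub]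

end CohRetract

end

section

variable {V W : Type v} [AddCommGroup V] [Module ℂ V] [AddCommGroup W] [Module ℂ W]

theorem tensor_act_even (R : SuperRep g V) (S : SuperRep g W) {a : g} (ha : a ∈ part g 0) :
    (R.tensor S).act a = map (R.act a) .id + map .id (S.act a) := by
  change tensorAct R S a = _
  simp [tensorAct, proj_of_mem ha]

theorem tensor_act_odd (R : SuperRep g V) (S : SuperRep g W) {a : g} (ha : a ∈ part g 1) (m : V)
    (n : W) : (R.tensor S).act a (m ⊗ₜ n) = R.act a m ⊗ₜ n + R.par m ⊗ₜ S.act a n := by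
  change tensorAct R S a (m ⊗ₜ n) = _
  simp [tensorAct, proj_of_mem ha]

namespace CohRetract

variable {R : SuperRep g V} {S : SuperRep g W} {x : SelfCommuting g} (D : CohRetract R x)
  (E : CohRetract S x)
include D E

theorem map_incl_mem_ker (t : R.Coh x ⊗[ℂ] S.Coh x) :
    (R.tensor S).act x.elt (map D.incl E.incl t) = 0 := by
  suffices (R.tensor S).act x.elt ∘ₗ map D.incl E.incl = 0 from LinearMap.congr_fun this t
  refine TensorProduct.ext' fun c d => ?_
  simp only [LinearMap.comp_apply, map_tmul, tensor_act_odd _ _ x.odd, act_incl, zero_tmul,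
    tmul_zero, add_zero, LinearMap.zero_apply]

theorem map_proj_act (z : V ⊗[ℂ] W) : map D.proj E.proj ((R.tensor S).act x.elt z) = 0 := by
  suffices map D.proj E.proj ∘ₗ (R.tensor S).act x.elt = 0 from LinearMap.congr_fun this z
  refine TensorProduct.ext' fun m n => ?_
  simp only [LinearMap.comp_apply, map_tmul, tensor_act_odd _ _ x.odd, map_add, proj_act,
    zero_tmul, tmul_zero, add_zero, LinearMap.zero_apply]

theorem map_proj_map_incl (t : R.Coh x ⊗[ℂ] S.Coh x) :
    map D.proj E.proj (map D.incl E.incl t) = t := by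
  suffices map D.proj E.proj ∘ₗ map D.incl E.incl = .id from LinearMap.congr_fun this t
  refine TensorProduct.ext' fun c d => ?_
  simp only [LinearMap.comp_apply, map_tmul, proj_incl, LinearMap.id_apply]

/-- The contracting homotopy of a tensor product of two deformation retracts. -/
def tensorHtpy : V ⊗[ℂ] W →ₗ[ℂ] V ⊗[ℂ] W :=
  map D.htpy .id + map (R.par ∘ₗ D.incl ∘ₗ D.proj) E.htpy

theorem map_incl_map_proj (z : V ⊗[ℂ] W) : map D.incl E.incl (map D.proj E.proj z) =
    z - (R.tensor S).act x.elt (D.tensorHtpy E z) - D.tensorHtpy E ((R.tensor S).act x.elt z) := by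
  suffices map D.incl E.incl ∘ₗ map D.proj E.proj = .id - (R.tensor S).act x.elt ∘ₗ
    D.tensorHtpy E - D.tensorHtpy E ∘ₗ (R.tensor S).act x.elt from LinearMap.congr_fun this z
  refine TensorProduct.ext' fun m n => ?_
  have hmn : m ⊗ₜ[ℂ] n = D.incl (D.proj m) ⊗ₜ n + R.act x.elt (D.htpy m) ⊗ₜ n +
      D.htpy (R.act x.elt m) ⊗ₜ n := by
    rw [← add_tmul, ← add_tmul, D.incl_proj]
    congr 1
    abel
  simp only [tensorHtpy, LinearMap.sub_apply, LinearMap.add_apply, LinearMap.comp_apply, map_tmul,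
    LinearMap.id_apply, map_add, tensor_act_odd _ _ x.odd, R.par_par, R.x_par, D.act_incl,
    D.proj_act, D.incl_proj_par, D.htpy_par, map_zero, neg_zero, zero_tmul, neg_tmul,
    E.incl_proj n, tmul_sub]
  rw [hmn]
  abel

/-- The isomorphism `V_x ⊗ W_x ≅ (V ⊗ W)_x` defined by a deformation retract onto each factor. -/
def kunneth : R.Coh x ⊗[ℂ] S.Coh x ≃ₗ[ℂ] (R.tensor S).Coh x :=
  .ofLinearMap ((R.tensor S).cls x ∘ₗ (map D.incl E.incl).codRestrict _ (D.map_incl_mem_ker E))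
    (Submodule.liftQ _ (map D.proj E.proj ∘ₗ (LinearMap.ker ((R.tensor S).act x.elt)).subtype) <| by
      rintro ⟨_, _⟩ ⟨z, rfl⟩
      exact D.map_proj_act E z)
    (LinearMap.ext <| ((R.tensor S).cls_surjective x).forall.mpr fun z =>
      ((R.tensor S).cls_eq_cls x).mpr ⟨-D.tensorHtpy E z, by
        change _ = map D.incl E.incl (map D.proj E.proj z) - z
        rw [D.map_incl_map_proj E, LinearMap.mem_ker.mp z.2, map_zero, map_neg]
        abel⟩)
    (LinearMap.ext (D.map_proj_map_incl E))

end CohRetract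

variable (R : SuperRep g V) (S : SuperRep g W) {x : SelfCommuting g}

theorem tmul_mem_ker {m : V} {n : W} (hm : R.act x.elt m = 0) (hn : S.act x.elt n = 0) :
    (R.tensor S).act x.elt (m ⊗ₜ n) = 0 := by
  rw [tensor_act_odd _ _ x.odd, hm, hn, zero_tmul, tmul_zero, add_zero]

variable {R S} in
theorem CohRetract.kunneth_cls (D : CohRetract R x) (E : CohRetract S x)
    (m : LinearMap.ker (R.act x.elt)) (n : LinearMap.ker (S.act x.elt)) :
    D.kunneth E (R.cls x m ⊗ₜ S.cls x n) =
      (R.tensor S).cls x ⟨m ⊗ₜ n, R.tmul_mem_ker S m.2 n.2⟩ := by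
  refine ((D.kunneth E).symm_apply_eq.mp ?_).symm
  exact congrArg₂ (· ⊗ₜ[ℂ] ·) (D.proj_coe m) (E.proj_coe n)

variable {R S} in
theorem CohRetract.isHom_kunneth (D : CohRetract R x) (E : CohRetract S x) :
    IsHom ((R.ds x).tensor (S.ds x)) ((R.tensor S).ds x) (D.kunneth E).toLinearMap := by
  refine .of_homog (fun t => ?_) fun i a ha t => ?_
  · induction t using TensorProduct.induction_on with
    | zero => simp only [map_zero]
    | add s t hs ht => simp only [map_add, hs, ht]
    | tmul m n =>
      obtain ⟨m, rfl⟩ := R.cls_surjective x m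
      obtain ⟨n, rfl⟩ := S.cls_surjective x n
      exact (D.kunneth_cls E ⟨_, R.par_mem_ker x m.2⟩ ⟨_, S.par_mem_ker x n.2⟩).trans
        (congrArg ((R.tensor S).cohPar x) (D.kunneth_cls E m n)).symm
  · induction t using tensor_induction (R.ds x).par_par (S.ds x).par_par with
    | zero => simp only [map_zero]
    | add s t hs ht => simp only [map_add, hs, ht]
    | tmul k l m hm n hn =>
      obtain ⟨m, hm', rfl⟩ := R.exists_homog_rep x hm
      obtain ⟨n, rfl⟩ := S.cls_surjective x n
      obtain ⟨a, ha', rfl⟩ := (adjoint g).exists_homog_rep x ha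
      have hm₁ := R.act_mem_ker x a.2 m.2
      have hn₁ := S.act_mem_ker x a.2 n.2
      refine (congrArg (D.kunneth E) (tensorAct_tmul (R.ds x) (S.ds x) ha hm _)).trans ?_
      rw [map_add, map_smul]
      refine (congrArg₂ (· + sgn (i * k) • ·) (D.kunneth_cls E ⟨_, hm₁⟩ n)
        (D.kunneth_cls E m ⟨_, hn₁⟩)).trans ?_
      refine Eq.trans ?_ (congrArg (((R.tensor S).ds x).act _) (D.kunneth_cls E m n)).symm
      change (R.tensor S).cls x _ + sgn (i * k) • (R.tensor S).cls x _ = (R.tensor S).cls x _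
      rw [← map_smul, ← map_add]
      exact congrArg _ (Subtype.ext (tensorAct_tmul R S ha' hm' (n : W)).symm)

end

end SuperRep

theorem SMod.tensor_DS (M N : SMod.{u, v} g) (x : SelfCommuting g) :
    Iso ((M.DS x).tensor (N.DS x)) ((M.tensor N).DS x) := by
  obtain ⟨D⟩ := M.rep.nonempty_cohRetract x
  obtain ⟨E⟩ := N.rep.nonempty_cohRetract x
  exact ⟨D.kunneth E, D.isHom_kunneth E⟩

namespace KRing

theorem isSuperEulerChar_cls_DS (x : SelfCommuting g) :
    SMod.IsSuperEulerChar fun M : SMod.{u, v} g => cls (M.DS x) where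
  map_exact h := cls_DS_eq_add h x
  map_shift M := (isSuperEulerChar_cls.map_iso (M.shift_DS x)).trans
    (isSuperEulerChar_cls.map_shift _)
  map_unit := (isSuperEulerChar_cls.map_iso (SMod.unit_DS x)).trans isSuperEulerChar_cls.map_unit
  map_tensor M N := (isSuperEulerChar_cls.map_iso (M.tensor_DS N x)).symm.trans
    (isSuperEulerChar_cls.map_tensor _ _)

theorem existsUnique_ds (x : SelfCommuting g) :
    ∃! φ : KRing.{u, v} g →+* KRing.{u, v} (DSAlg x), ∀ M, φ (cls M) = cls (M.DS x) :=
  ⟨lift (isSuperEulerChar_cls_DS x), lift_cls _, fun _ hφ => RingHom.ext <|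
    cls_surjective.forall.mpr fun M => (hφ M).trans (lift_cls (isSuperEulerChar_cls_DS x) M).symm⟩

end KRing

/-! ### Traces of exponentials -/

section ExpTrace

variable {K : Type*} [Field K] {V W : Type*} [AddCommGroup V] [Module K V]
  [AddCommGroup W] [Module K W]

/-- The formal power series `tr (θ exp (T X))`. For `θ` the grading involution and `T` the action
of an even element, this is the supertrace of the exponential. -/
def expTrace (θ T : Module.End K V) : PowerSeries K :=
  .mk fun k => LinearMap.trace K V (θ * T ^ k) * (k.factorial : K)⁻¹

theorem coeff_expTrace (θ T : Module.End K V) (k : ℕ) :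
    PowerSeries.coeff k (expTrace θ T) =
      LinearMap.trace K V (θ * T ^ k) * (k.factorial : K)⁻¹ :=
  PowerSeries.coeff_mk _ _

theorem expTrace_neg (θ T : Module.End K V) : expTrace (-θ) T = -expTrace θ T := by
  ext k
  rw [map_neg, coeff_expTrace, coeff_expTrace, neg_mul, map_neg, neg_mul]

theorem trace_mul_pow_of_commute_of_isNilpotent {θ T : Module.End K V} {c : K}
    (hcomm : Commute θ T) (hT : IsNilpotent (T - algebraMap K _ c)) (k : ℕ) :
    LinearMap.trace K V (θ * T ^ k) = LinearMap.trace K V θ * c ^ k := by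
  induction k with
  | zero => rw [pow_zero, pow_zero, mul_one, mul_one]
  | succ k ih =>
    rw [pow_succ, ← mul_assoc, pow_succ, ← mul_assoc, ← ih, mul_comm _ c]
    exact LinearMap.trace_comp_eq_mul_of_commute_of_isNilpotent c
      (hcomm.mul_left ((Commute.refl T).pow_left k)) hT

theorem expTrace_eq_sum_restrict [FiniteDimensional K V] {ι : Type*} [Fintype ι] [DecidableEq ι]
    {U : ι → Submodule K V} (hU : DirectSum.IsInternal U) {θ T : Module.End K V}
    (hθ : ∀ i, ∀ m ∈ U i, θ m ∈ U i) (hT : ∀ i, ∀ m ∈ U i, T m ∈ U i) :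
    expTrace θ T = ∑ i, expTrace (θ.restrict (hθ i)) (T.restrict (hT i)) := by
  ext k
  have hTk i := Module.End.pow_apply_mem_of_forall_mem k (hT i)
  rw [map_sum, coeff_expTrace,
    LinearMap.trace_eq_sum_trace_restrict hU (f := θ * T ^ k)
      (fun i m hm => hθ i _ (hTk i m hm)), Finset.sum_mul]
  refine Finset.sum_congr rfl fun i _ => ?_
  rw [coeff_expTrace, Module.End.pow_restrict]
  rfl

section Exact

variable {V₁ V₂ V₃ : Type*} [AddCommGroup V₁] [Module K V₁] [FiniteDimensional K V₁]
  [AddCommGroup V₂] [Module K V₂] [FiniteDimensional K V₂] [AddCommGroup V₃] [Module K V₃]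
  [FiniteDimensional K V₃] {f : V₁ →ₗ[K] V₂} {p : V₂ →ₗ[K] V₃}

theorem trace_eq_add_of_exact (hf : Function.Injective f) (hfp : Function.Exact f p)
    (hp : Function.Surjective p) {T₁ : Module.End K V₁} {T₂ : Module.End K V₂}
    {T₃ : Module.End K V₃} (h₁ : T₂ ∘ₗ f = f ∘ₗ T₁) (h₃ : T₃ ∘ₗ p = p ∘ₗ T₂) :
    LinearMap.trace K V₂ T₂ = LinearMap.trace K V₁ T₁ + LinearMap.trace K V₃ T₃ := by
  obtain ⟨s, hs⟩ := p.exists_rightInverse_of_surjective (LinearMap.range_eq_top.mpr hp)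
  obtain ⟨r, hr⟩ := f.exists_leftInverse_of_injective (LinearMap.ker_eq_bot.mpr hf)
  let q : V₂ →ₗ[K] V₁ := r ∘ₗ (.id - s ∘ₗ p)
  have hqf : q ∘ₗ f = .id := by
    rw [LinearMap.comp_assoc, LinearMap.sub_comp, LinearMap.comp_assoc, hfp.linearMap_comp_eq_zero,
      LinearMap.comp_zero, sub_zero, LinearMap.id_comp, hr]
  have hsplit : f ∘ₗ q + s ∘ₗ p = .id := by
    ext m
    obtain ⟨l, hl⟩ := (hfp (m - s (p m))).mp
      (by rw [map_sub, sub_eq_zero]; exact (LinearMap.congr_fun hs (p m)).symm)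
    change f (r (m - s (p m))) + s (p m) = m
    rw [← hl, show r (f l) = l from LinearMap.congr_fun hr l, hl, sub_add_cancel]
  calc LinearMap.trace K V₂ T₂
      = LinearMap.trace K V₂ (T₂ ∘ₗ (f ∘ₗ q + s ∘ₗ p)) := by rw [hsplit, LinearMap.comp_id]
    _ = LinearMap.trace K V₂ (f ∘ₗ T₁ ∘ₗ q) + LinearMap.trace K V₂ ((T₂ ∘ₗ s) ∘ₗ p) := by
        rw [LinearMap.comp_add, map_add, ← LinearMap.comp_assoc, h₁, LinearMap.comp_assoc,
          LinearMap.comp_assoc]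
    _ = LinearMap.trace K V₁ T₁ + LinearMap.trace K V₃ T₃ := by
        rw [LinearMap.trace_comp_comm' (T₁ ∘ₗ q) f, LinearMap.trace_comp_comm' p (T₂ ∘ₗ s),
          LinearMap.comp_assoc, hqf, LinearMap.comp_id, ← LinearMap.comp_assoc, ← h₃,
          LinearMap.comp_assoc, hs, LinearMap.comp_id]

theorem expTrace_eq_add_of_exact (hf : Function.Injective f) (hfp : Function.Exact f p)
    (hp : Function.Surjective p) {θ₁ T₁ : Module.End K V₁} {θ₂ T₂ : Module.End K V₂}
    {θ₃ T₃ : Module.End K V₃} (hθ₁ : θ₂ ∘ₗ f = f ∘ₗ θ₁) (hT₁ : T₂ ∘ₗ f = f ∘ₗ T₁)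
    (hθ₃ : θ₃ ∘ₗ p = p ∘ₗ θ₂) (hT₃ : T₃ ∘ₗ p = p ∘ₗ T₂) :
    expTrace θ₂ T₂ = expTrace θ₁ T₁ + expTrace θ₃ T₃ := by
  ext k
  rw [map_add, coeff_expTrace, coeff_expTrace, coeff_expTrace, ← add_mul]
  refine congrArg (· * _) (trace_eq_add_of_exact hf hfp hp ?_ ?_)
  · rw [Module.End.mul_eq_comp, LinearMap.comp_assoc,
      Module.End.commute_pow_left_of_commute hT₁ k, ← LinearMap.comp_assoc, hθ₁]
    rfl
  · rw [Module.End.mul_eq_comp, LinearMap.comp_assoc,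
      Module.End.commute_pow_left_of_commute hT₃ k, ← LinearMap.comp_assoc, hθ₃]
    rfl

end Exact

section Tensor

variable [FiniteDimensional K V] [FiniteDimensional K W]

theorem trace_tensor_mul_pow (θ T : Module.End K V) (η S : Module.End K W) (k : ℕ) :
    LinearMap.trace K (V ⊗[K] W) (map θ η * (map T .id + map .id S : Module.End K (V ⊗[K] W)) ^ k) =
      ∑ p ∈ Finset.HasAntidiagonal.antidiagonal k, k.choose p.1 *
        (LinearMap.trace K V (θ * T ^ p.1) * LinearMap.trace K W (η * S ^ p.2)) := by
  have hcomm : Commute (map T .id : Module.End K (V ⊗[K] W)) (map .id S) := by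
    ext m n
    rfl
  rw [hcomm.add_pow', Finset.mul_sum, map_sum]
  refine Finset.sum_congr rfl fun p _ => ?_
  have hpow : (map T .id : Module.End K (V ⊗[K] W)) ^ p.1 * (map .id S) ^ p.2 =
      map (T ^ p.1) (S ^ p.2) := by
    rw [TensorProduct.map_pow, TensorProduct.map_pow, ← TensorProduct.map_mul,
      ← Module.End.one_eq_id, ← Module.End.one_eq_id, one_pow, one_pow, mul_one, one_mul]
  rw [mul_smul_comm, map_nsmul, nsmul_eq_mul, hpow, ← TensorProduct.map_mul,
    LinearMap.trace_tensorProduct']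

end Tensor

variable [CharZero K]

theorem expTrace_eq_zero_iff {θ T : Module.End K V} :
    expTrace θ T = 0 ↔ ∀ k, LinearMap.trace K V (θ * T ^ k) = 0 := by
  simp only [PowerSeries.ext_iff, coeff_expTrace, map_zero, mul_eq_zero, inv_eq_zero,
    Nat.cast_eq_zero, Nat.factorial_ne_zero, or_false]

theorem expTrace_of_commute_of_isNilpotent {θ T : Module.End K V} {c : K} (hcomm : Commute θ T)
    (hT : IsNilpotent (T - algebraMap K _ c)) :
    expTrace θ T = LinearMap.trace K V θ • PowerSeries.rescale c (PowerSeries.exp K) := by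
  ext k
  rw [coeff_expTrace, trace_mul_pow_of_commute_of_isNilpotent hcomm hT, PowerSeries.coeff_smul,
    PowerSeries.coeff_rescale, PowerSeries.coeff_exp]
  simp only [one_div, map_inv₀, map_natCast, smul_eq_mul, mul_assoc]

theorem expTrace_tensor [FiniteDimensional K V] [FiniteDimensional K W]
    (θ T : Module.End K V) (η S : Module.End K W) :
    expTrace (map θ η : Module.End K (V ⊗[K] W)) (map T .id + map .id S) =
      expTrace θ T * expTrace η S := by
  ext k
  rw [PowerSeries.coeff_mul, coeff_expTrace, trace_tensor_mul_pow, Finset.sum_mul]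
  refine Finset.sum_congr rfl fun p hp => ?_
  obtain rfl := Finset.HasAntidiagonal.mem_antidiagonal.mp hp
  have hfact : ((p.1 + p.2).choose p.1 : K) * p.1.factorial * p.2.factorial =
      (p.1 + p.2).factorial := by
    rw [Nat.choose_symm_add]
    exact_mod_cast Nat.add_choose_mul_factorial_mul_factorial p.1 p.2
  have hne (n : ℕ) : (n.factorial : K) ≠ 0 := Nat.cast_ne_zero.mpr n.factorial_ne_zero
  rw [coeff_expTrace, coeff_expTrace]
  field_simp [hne]
  rw [← hfact]
  ring

end ExpTrace

section ExpEval

variable {h : Type*} [AddCommGroup h] [Module ℂ h]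

/-- The function `a ↦ exp (μ(a) X)` on `h`, as a homomorphism to formal power series. -/
def expHom (μ : Module.Dual ℂ h) : Multiplicative h →* PowerSeries ℂ where
  toFun a := PowerSeries.rescale (μ a.toAdd) (PowerSeries.exp ℂ)
  map_one' := by simp
  map_mul' a b := by rw [PowerSeries.exp_mul_exp_eq_exp_add, ← map_add]; rfl

theorem expHom_injective : Function.Injective (expHom (h := h)) := by
  intro μ ν hμν
  ext a
  have hcoeff := congrArg (PowerSeries.coeff 1) (DFunLike.congr_fun hμν (.ofAdd a))
  simpa [expHom, PowerSeries.coeff_rescale, PowerSeries.coeff_exp] using hcoeff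

variable (h) in
/-- The realization of `ℤ[h^*]` as functions on `h`, `e^μ` being the function `a ↦ exp (μ(a) X)`
with values in formal power series. -/
def expEval : AddMonoidAlgebra ℤ (Module.Dual ℂ h) →+* (h → PowerSeries ℂ) :=
  (AddMonoidAlgebra.lift ℤ (h → PowerSeries ℂ) (Module.Dual ℂ h)
    { toFun := fun μ a => expHom μ.toAdd (.ofAdd a)
      map_one' := by ext1 a; simp [expHom]
      map_mul' := fun μ ν => by
        ext1 a
        exact (PowerSeries.exp_mul_exp_eq_exp_add _ _).symm }).toRingHom

theorem expEval_single (μ : Module.Dual ℂ h) (n : ℤ) (a : h) :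
    expEval h (.single μ n) a = n • expHom μ (.ofAdd a) := by
  change AddMonoidAlgebra.lift ℤ (h → PowerSeries ℂ) (Module.Dual ℂ h) _ _ a = _
  rw [AddMonoidAlgebra.lift_single]
  rfl

theorem expEval_apply (F : AddMonoidAlgebra ℤ (Module.Dual ℂ h)) (a : h) :
    expEval h F a = ∑ μ ∈ F.coeff.support, F.coeff μ • expHom μ (.ofAdd a) := by
  change AddMonoidAlgebra.lift ℤ (h → PowerSeries ℂ) (Module.Dual ℂ h) _ F a = _
  rw [AddMonoidAlgebra.lift_apply, Finsupp.sum, Finset.sum_apply]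
  rfl

/-- Distinct homomorphisms from a monoid to a domain are linearly independent. -/
theorem expEval_injective : Function.Injective (expEval h) := by
  rw [injective_iff_map_eq_zero]
  intro F hF
  have hli := (linearIndependent_monoidHom (Multiplicative h) (PowerSeries ℂ)).comp _
    expHom_injective
  have : CharZero (PowerSeries ℂ) := algebraRat.charZero _
  have hcoeff := linearIndependent_iff'.mp hli F.coeff.support (fun μ => F.coeff μ) <| by
    ext1 a
    simpa only [Finset.sum_apply, Pi.smul_apply, zsmul_eq_mul, smul_eq_mul, Function.comp_apply,
      ofAdd_toAdd, Pi.zero_apply] using (expEval_apply F a.toAdd).symm.trans (congrFun hF a.toAdd)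
  have hzero : F.coeff = 0 := Finsupp.support_eq_empty.mp <| Finset.eq_empty_of_forall_notMem
    fun μ hμ => Finsupp.mem_support_iff.mp hμ (Int.cast_eq_zero.mp (hcoeff μ hμ))
  rw [← AddMonoidAlgebra.ofCoeff_coeff F, hzero, AddMonoidAlgebra.ofCoeff_zero]

theorem expEval_restrictExp {t : Type*} [AddCommGroup t] [Module ℂ t] (ι : t →ₗ[ℂ] h) (a : t)
    (F : AddMonoidAlgebra ℤ (Module.Dual ℂ h)) :
    expEval t (restrictExp ι F) a = expEval h F (ι a) := by
  induction F using AddMonoidAlgebra.induction_linear with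
  | zero => rw [restrictExp, AddMonoidAlgebra.mapDomain_zero, map_zero, map_zero]; rfl
  | add F G hF hG =>
    rw [restrictExp, AddMonoidAlgebra.mapDomain_add, map_add, map_add]
    exact congrArg₂ (· + ·) hF hG
  | single μ n =>
    rw [restrictExp, AddMonoidAlgebra.mapDomain_single, expEval_single, expEval_single]
    rfl

end ExpEval

/-! ### Supercharacters as functions on the Cartan subalgebra -/

section WeightSpaces

open LieModule

variable {K L M : Type*} [Field K] [LieRing L] [LieRing.IsNilpotent L] [LieAlgebra K L]
  [AddCommGroup M] [Module K M] [LieRingModule L M] [LieModule K L M]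

theorem map_mem_genWeightSpace (θ : M →ₗ⁅K,L⁆ M) (χ : L → K) {m : M}
    (hm : m ∈ (genWeightSpace M χ).toSubmodule) :
    (θ : M →ₗ[K] M) m ∈ (genWeightSpace M χ).toSubmodule :=
  map_genWeightSpace_le θ (LieSubmodule.mem_map_of_mem hm)

/-- The endomorphism of a weight space induced by an endomorphism of the module. -/
def genWeightSpaceMap (θ : M →ₗ⁅K,L⁆ M) (χ : L → K) : Module.End K (genWeightSpace M χ) :=
  (θ : M →ₗ[K] M).restrict fun _ => map_mem_genWeightSpace θ χ

theorem expTrace_toEnd_eq_sum [CharZero K] [FiniteDimensional K M] [IsTriangularizable K L M]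
    (θ : M →ₗ⁅K,L⁆ M) (a : L) :
    expTrace (θ : Module.End K M) (toEnd K L M a) =
      ∑ χ : Weight K L M, LinearMap.trace K _ (genWeightSpaceMap θ χ) •
        PowerSeries.rescale (χ a) (PowerSeries.exp K) := by
  classical
  have hdirect := DirectSum.isInternal_submodule_of_iSupIndep_of_iSup_eq_top
    (LieSubmodule.iSupIndep_toSubmodule.mpr (iSupIndep_genWeightSpace' K L M))
    (LieSubmodule.iSup_toSubmodule_eq_top.mpr (iSup_genWeightSpace_eq_top' K L M))
  rw [expTrace_eq_sum_restrict hdirect (fun χ _ => map_mem_genWeightSpace θ χ)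
    (fun χ _ => (genWeightSpace M χ).lie_mem)]
  exact Finset.sum_congr rfl fun χ _ => expTrace_of_commute_of_isNilpotent
    (LinearMap.ext fun m => Subtype.ext (θ.map_lie a m)) (isNilpotent_toEnd_sub_algebraMap M χ a)

end WeightSpaces

theorem trace_eq_finrank_homog_sub {V : Type*} [AddCommGroup V] [Module ℂ V]
    [FiniteDimensional ℂ V] {θ : V →ₗ[ℂ] V} (hθ : ∀ v, θ (θ v) = v) :
    LinearMap.trace ℂ V θ =
      (Module.finrank ℂ (homog θ 0) : ℂ) - Module.finrank ℂ (homog θ 1) := by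
  have hproj (i : ZMod 2) : LinearMap.IsProj (homog θ i) (proj θ i) :=
    ⟨proj_mem hθ i, fun v hv => by rw [proj_of_mem hv, if_pos rfl]⟩
  have hsub : proj θ 0 - proj θ 1 = θ := by
    ext v
    simp only [LinearMap.sub_apply, proj_apply, sgn_zero, sgn_one]
    module
  rw [← (hproj 0).trace, ← (hproj 1).trace, ← map_sub, hsub]

namespace SMod

/-- The parity involution, as an endomorphism of the module over the even part. -/
def parHom (M : SMod.{u, v} g) : M.carrier →ₗ⁅ℂ, part g 0⁆ M.carrier :=
  { M.rep.par with
    map_lie' := fun {a m} => by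
      change M.rep.par (M.rep.act (a : g) m) = M.rep.act (a : g) (M.rep.par m)
      rw [M.rep.par_act, mem_homog.mp a.2, sgn_zero, one_smul] }

/-- The generating series `str_M (exp (a X))` of the supertraces of the powers of `a`. -/
def strSeries (M : SMod.{u, v} g) (a : g) : PowerSeries ℂ :=
  expTrace M.rep.par (M.rep.act a)

theorem strSeries_unit (a : g) : (unit.{u, v} g).strSeries a = 1 := by
  have htrace : LinearMap.trace ℂ (ULift.{v} ℂ) 1 = 1 := by
    rw [LinearMap.trace_one, ULift.moduleEquiv.finrank_eq, Module.finrank_self, Nat.cast_one]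
  ext k
  rw [strSeries, coeff_expTrace, PowerSeries.coeff_one]
  change LinearMap.trace ℂ (ULift.{v} ℂ) (1 * 0 ^ k) * _ = _
  split_ifs with hk
  · rw [hk, pow_zero, one_mul, htrace, Nat.factorial_zero, Nat.cast_one, inv_one, mul_one]
  · rw [zero_pow hk, mul_zero, map_zero, zero_mul]

theorem isSuperEulerChar_strSeries {a : g} (ha : a ∈ part g 0) :
    IsSuperEulerChar fun M : SMod.{u, v} g => M.strSeries a where
  map_exact := by
    rintro M₁ M₂ M₃ ⟨f, p, hf, hp, hinj, hex, hsurj⟩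
    exact expTrace_eq_add_of_exact hinj hex hsurj
      (LinearMap.ext fun m => (hf.map_par m).symm) (LinearMap.ext fun m => (hf.map_act a m).symm)
      (LinearMap.ext fun m => (hp.map_par m).symm) (LinearMap.ext fun m => (hp.map_act a m).symm)
  map_shift M := expTrace_neg M.rep.par (M.rep.act a)
  map_unit := strSeries_unit a
  map_tensor M N :=
    (congrArg (expTrace (map M.rep.par N.rep.par)) (M.rep.tensor_act_even N.rep ha)).trans
      (expTrace_tensor M.rep.par (M.rep.act a) N.rep.par (N.rep.act a))

end SMod

section Supercharacter

variable (h : LieSubalgebra ℂ (part g 0)) [LieRing.IsNilpotent h]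

theorem finrank_weightPart (M : SMod.{u, v} g) (μ : Module.Dual ℂ h) (i : ZMod 2) :
    Module.finrank ℂ (weightPart h M μ i) =
      Module.finrank ℂ (homog (genWeightSpaceMap (M.parHom.restrictLie h) μ) i) := by
  refine Eq.trans (congrArg (fun S : Submodule ℂ M.carrier => Module.finrank ℂ S) ?_)
    (Submodule.finrank_map_subtype_eq
      (LieModule.genWeightSpace M.carrier (μ : h → ℂ)).toSubmodule _)
  ext m
  simp only [weightPart, Submodule.mem_inf, Submodule.mem_map, mem_homog]
  constructor
  · rintro ⟨hm, hpar⟩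
    exact ⟨⟨m, hm⟩, Subtype.ext hpar, rfl⟩
  · rintro ⟨n, hn, rfl⟩
    exact ⟨n.2, congrArg Subtype.val hn⟩

theorem trace_parHom_genWeightSpace (M : SMod.{u, v} g) (μ : Module.Dual ℂ h) :
    LinearMap.trace ℂ _ (genWeightSpaceMap (M.parHom.restrictLie h) μ) = weightSdim h M μ := by
  rw [trace_eq_finrank_homog_sub fun m => Subtype.ext (M.rep.par_par m), weightSdim,
    finrank_weightPart, finrank_weightPart, Int.cast_sub, Int.cast_natCast, Int.cast_natCast]

theorem weightSdim_eq_zero {M : SMod.{u, v} g} {μ : Module.Dual ℂ h}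
    (hμ : LieModule.genWeightSpace M.carrier (μ : h → ℂ) = ⊥) : weightSdim h M μ = 0 := by
  have hpart (i : ZMod 2) : weightPart h M μ i = ⊥ := by
    rw [weightPart, hμ, LieSubmodule.bot_toSubmodule, bot_inf_eq]
  rw [weightSdim, hpart, hpart, sub_self]

theorem coeff_sch (M : SMod.{u, v} g) (μ : Module.Dual ℂ h) :
    (sch h M).coeff μ = weightSdim h M μ :=
  rfl

theorem sch_eq_sum_weight (M : SMod.{u, v} g) :
    sch h M = ∑ χ : LieModule.Weight ℂ h M.carrier,
      .single χ.toLinear (weightSdim h M χ.toLinear) := by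
  classical
  ext μ
  rw [coeff_sch, AddMonoidAlgebra.coeff_sum, Finsupp.finsetSum_apply]
  simp only [AddMonoidAlgebra.coeff_single, Finsupp.single_apply]
  by_cases hμ : LieModule.genWeightSpace M.carrier (μ : h → ℂ) = ⊥
  · rw [weightSdim_eq_zero h hμ, Finset.sum_eq_zero]
    rintro χ -
    refine if_neg ?_
    rintro rfl
    exact χ.genWeightSpace_ne_bot' hμ
  · rw [Finset.sum_eq_single_of_mem (⟨μ, hμ⟩ : LieModule.Weight ℂ h M.carrier)
      (Finset.mem_univ _)]
    · exact (if_pos rfl).symm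
    · rintro χ - hχ
      exact if_neg fun hχμ => hχ (LieModule.Weight.ext fun a => LinearMap.congr_fun hχμ a)

theorem expEval_sch (M : SMod.{u, v} g) (a : h) :
    expEval h (sch h M) a = M.strSeries ((a : part g 0) : g) := by
  rw [sch_eq_sum_weight, map_sum, Finset.sum_apply]
  refine (Finset.sum_congr rfl fun χ _ => ?_).trans
    (expTrace_toEnd_eq_sum (M.parHom.restrictLie h) a).symm
  have htrace : LinearMap.trace ℂ _ (genWeightSpaceMap (M.parHom.restrictLie h) χ) =
      weightSdim h M χ.toLinear := trace_parHom_genWeightSpace h M χ.toLinear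
  rw [expEval_single, htrace, Int.cast_smul_eq_zsmul]
  rfl

theorem isSuperEulerChar_sch : SMod.IsSuperEulerChar (sch.{u, v} h) where
  map_exact hM := expEval_injective <| funext fun a => by
    rw [map_add, Pi.add_apply, expEval_sch, expEval_sch, expEval_sch]
    exact (SMod.isSuperEulerChar_strSeries (Subtype.prop _)).map_exact hM
  map_shift M := expEval_injective <| funext fun a => by
    rw [map_neg, Pi.neg_apply, expEval_sch, expEval_sch]
    exact (SMod.isSuperEulerChar_strSeries (Subtype.prop _)).map_shift M
  map_unit := expEval_injective <| funext fun a => by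
    rw [map_one, Pi.one_apply, expEval_sch, SMod.strSeries_unit]
  map_tensor M N := expEval_injective <| funext fun a => by
    rw [map_mul, Pi.mul_apply, expEval_sch, expEval_sch, expEval_sch]
    exact (SMod.isSuperEulerChar_strSeries (Subtype.prop _)).map_tensor M N

theorem range_lift_sch :
    Set.range (KRing.lift (isSuperEulerChar_sch.{u, v} h)) = Set.range (sch.{u, v} h) := by
  rw [← KRing.cls_surjective.range_comp]
  exact congrArg Set.range (funext (KRing.lift_cls _))

theorem coe_JRing :
    (JRing.{u, v} h : Set (AddMonoidAlgebra ℤ (Module.Dual ℂ h))) = Set.range (sch.{u, v} h) := by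
  rw [JRing, ← range_lift_sch.{u, v}, ← RingHom.coe_range, Subring.closure_eq]

/-- The surjection `K_g → J_g`, `[M] ↦ sch M`. -/
def KRing.toJRing : KRing.{u, v} g →+* JRing.{u, v} h :=
  (lift (isSuperEulerChar_sch h)).codRestrict _ <|
    cls_surjective.forall.mpr fun M => by
      rw [lift_cls]; exact (JRing.cls h M).2

theorem KRing.toJRing_cls (M : SMod.{u, v} g) : toJRing h (cls M) = JRing.cls h M :=
  Subtype.ext (lift_cls _ M)

theorem JRing.cls_surjective : Function.Surjective (JRing.cls.{u, v} h) := by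
  rintro ⟨F, hF⟩
  obtain ⟨M, rfl⟩ := (coe_JRing h).subset hF
  exact ⟨M, rfl⟩

theorem KRing.toJRing_surjective : Function.Surjective (toJRing.{u, v} h) :=
  (JRing.cls_surjective h).forall.mpr fun M => ⟨cls M, toJRing_cls h M⟩

end Supercharacter

/-! ### Supertraces on cohomology -/

theorem SuperRep.trace_coh {V : Type v} [AddCommGroup V] [Module ℂ V] [FiniteDimensional ℂ V]
    {R : SuperRep g V} {x : SelfCommuting g} {T : Module.End ℂ V}
    (hT : T * R.act x.elt = -(R.act x.elt * T))
    (hker : ∀ m ∈ LinearMap.ker (R.act x.elt), T m ∈ LinearMap.ker (R.act x.elt))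
    {T' : Module.End ℂ (R.Coh x)} (hT' : T' ∘ₗ R.cls x = R.cls x ∘ₗ T.restrict hker) :
    LinearMap.trace ℂ (R.Coh x) T' = LinearMap.trace ℂ V T := by
  obtain ⟨D⟩ := R.nonempty_cohRetract x
  have hT'_eq : T' = D.proj ∘ₗ T ∘ₗ D.incl := by
    ext c
    calc T' c = T' (R.cls x ⟨D.incl c, D.act_incl c⟩) := by rw [← D.proj_coe, D.proj_incl]
      _ = R.cls x ⟨T (D.incl c), hker _ (D.act_incl c)⟩ := LinearMap.congr_fun hT' _
      _ = D.proj (T (D.incl c)) := (D.proj_coe _).symm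
  have hT_eq :
      T = T * (D.incl ∘ₗ D.proj) + T * R.act x.elt * D.htpy + T * D.htpy * R.act x.elt := by
    ext m
    change T m = T (D.incl (D.proj m)) + T (R.act x.elt (D.htpy m)) + T (D.htpy (R.act x.elt m))
    rw [D.incl_proj, map_sub, map_sub]
    abel
  have hcancel : LinearMap.trace ℂ V (T * R.act x.elt * D.htpy) +
      LinearMap.trace ℂ V (T * D.htpy * R.act x.elt) = 0 := by
    rw [LinearMap.trace_mul_comm ℂ (T * D.htpy), hT, neg_mul, map_neg, mul_assoc, neg_add_cancel]
  rw [hT'_eq, LinearMap.trace_comp_comm' (T ∘ₗ D.incl) D.proj, LinearMap.comp_assoc]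
  conv_rhs => rw [hT_eq, map_add, map_add, add_assoc, hcancel, add_zero]
  rfl

/-- Since `x` is odd, an even element of `g^x` composed with the parity involution anticommutes
with `x`, so that its trace is preserved by passing to cohomology. -/
theorem SMod.strSeries_DS (M : SMod.{u, v} g) (x : SelfCommuting g)
    (c : LinearMap.ker ((SuperRep.adjoint g).act x.elt)) (hc : (c : g) ∈ part g 0) :
    (M.DS x).strSeries ((SuperRep.adjoint g).cls x c) = M.strSeries (c : g) := by
  have hcomm : Commute (M.rep.act (c : g)) (M.rep.act x.elt) := LinearMap.ext fun m => by
    change M.rep.act _ (M.rep.act _ m) = M.rep.act _ (M.rep.act _ m)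
    rw [M.rep.act_x_comm x c.2, mem_homog.mp hc, sgn_zero, one_smul]
  have hanti : M.rep.par * M.rep.act x.elt = -(M.rep.act x.elt * M.rep.par) :=
    LinearMap.ext (M.rep.par_x x)
  have hker : ∀ m ∈ LinearMap.ker (M.rep.act x.elt),
      M.rep.act (c : g) m ∈ LinearMap.ker (M.rep.act x.elt) := fun _ => M.rep.act_mem_ker x c.2
  have hpow (k : ℕ) : (M.rep.cohAct x ((SuperRep.adjoint g).cls x c) ^ k) ∘ₗ M.rep.cls x =
      M.rep.cls x ∘ₗ (M.rep.act (c : g) ^ k).restrict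
        (Module.End.pow_apply_mem_of_forall_mem k hker) := by
    rw [← Module.End.pow_restrict k hker]
    exact Module.End.commute_pow_left_of_commute (f := M.rep.cls x) rfl k
  ext k
  rw [strSeries, strSeries, coeff_expTrace, coeff_expTrace]
  refine congrArg (· * _) (SuperRep.trace_coh ?_ (fun m hm => M.rep.par_mem_ker x
    (m := (M.rep.act (c : g) ^ k) m) (Module.End.pow_apply_mem_of_forall_mem k hker m hm)) ?_)
  · rw [mul_assoc, (hcomm.pow_left k).eq, ← mul_assoc, hanti, neg_mul, mul_assoc]
  · exact congrArg (M.rep.cohPar x ∘ₗ ·) (hpow k)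

/-! ### Invariant functions on a Lie algebra -/

section RegularElement

variable {K L : Type*} [Field K] [LieRing L] [LieAlgebra K L]

theorem isUnit_toEnd_genWeightSpace [LieRing.IsNilpotent L] {V : Type*} [AddCommGroup V]
    [Module K V] [LieRingModule L V] [LieModule K L V] [IsNoetherian K V] {χ : L → K} {y : L}
    (hχ : χ y ≠ 0) : IsUnit (LieModule.toEnd K L (LieModule.genWeightSpace V χ) y) := by
  have hunit := (LieModule.isNilpotent_toEnd_sub_algebraMap V χ y).isUnit_add_right_of_commute
    ((IsUnit.mk0 _ hχ).map (algebraMap K _)) (Algebra.commutes (χ y) _).symm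
  exact (congrArg IsUnit (sub_add_cancel _ _)).mp hunit

theorem exists_cartan_sup_range_ad_eq_top [Infinite K] [FiniteDimensional K L]
    (h : LieSubalgebra K L) [h.IsCartanSubalgebra] [LieModule.IsTriangularizable K h L]
    [LieModule.LinearWeights K h L] :
    ∃ y : h, h.toSubmodule ⊔ LinearMap.range (LieAlgebra.ad K L y) = ⊤ := by
  obtain ⟨y, hy⟩ := Module.Dual.exists_forall_ne_zero_of_forall_exists
    (fun α : {α : LieModule.Weight K h L // α.IsNonZero} => α.1.toLinear)
    (fun α => Function.ne_iff.mp α.2)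
  refine ⟨y, eq_top_iff.mpr ?_⟩
  have hroots := congrArg LieSubmodule.toSubmodule
    (LieAlgebra.cartan_sup_iSup_rootSpace_eq_top (K := K) (L := L) (H := h))
  simp only [LieSubmodule.sup_toSubmodule, LieSubmodule.iSup_toSubmodule,
    LieSubmodule.top_toSubmodule] at hroots
  rw [← hroots]
  refine sup_le le_sup_left (iSup₂_le fun α hα => le_sup_of_le_right fun m hm => ?_)
  have hunit := isUnit_toEnd_genWeightSpace (V := L) (χ := α) (y := y) (hy ⟨α, hα⟩)
  obtain ⟨n, hn⟩ := ((Module.End.isUnit_iff _).mp hunit).surjective ⟨m, hm⟩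
  exact ⟨n, congrArg Subtype.val hn⟩

end RegularElement

section InvariantFunctions

open Filter Topology

theorem hasDerivAt_pow_of_lie {𝕜 A : Type*} [NontriviallyNormedField 𝕜] [NormedRing A]
    [NormedAlgebra 𝕜 A] {u : 𝕜 → A} {X : A} {s : 𝕜} (hu : HasDerivAt u ⁅X, u s⁆ s) (k : ℕ) :
    HasDerivAt (fun r => u r ^ k) ⁅X, u s ^ k⁆ s := by
  induction k with
  | zero =>
    simpa only [pow_zero, Ring.lie_def, mul_one, one_mul, sub_self] using hasDerivAt_const s 1
  | succ k ih =>
    simp only [pow_succ]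
    refine (ih.mul hu).congr_deriv ?_
    simp only [Ring.lie_def]
    noncomm_ring

variable {A E H : Type*} [NormedRing A] [NormedAlgebra ℂ A]
  [NormedAddCommGroup E] [NormedSpace ℂ E] [CompleteSpace E]

theorem trace_mul_pow_exp_ad (τ : A →L[ℂ] ℂ) (hτ : ∀ a b, τ (a * b) = τ (b * a)) {θ : A}
    {ρ : E →L[ℂ] A} (hθ : ∀ x, Commute θ (ρ x)) {ad : E →L[ℂ] E →L[ℂ] E}
    (hρ : ∀ x y, ρ (ad x y) = ⁅ρ x, ρ y⁆) (k : ℕ) (x y : E) :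
    τ (θ * ρ (NormedSpace.exp (ad x) y) ^ k) = τ (θ * ρ y ^ k) := by
  let u (s : ℂ) : A := ρ (NormedSpace.exp (s • ad x) y)
  have hu (s : ℂ) : HasDerivAt u ⁅ρ x, u s⁆ s := by
    refine (ρ.hasFDerivAt.comp_hasDerivAt s <|
      (hasDerivAt_exp_smul_const' (ad x) s).clm_apply (hasDerivAt_const s y)).congr_deriv ?_
    rw [map_zero, add_zero]
    exact hρ x _
  have hF (s : ℂ) : HasDerivAt (fun r => τ (θ * u r ^ k)) 0 s := by
    refine (τ.hasFDerivAt.comp_hasDerivAt s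
      ((hasDerivAt_pow_of_lie (hu s) k).const_mul θ)).congr_deriv ?_
    rw [Ring.lie_def, mul_sub, map_sub, ← mul_assoc, (hθ x).eq, mul_assoc, hτ (ρ x), mul_assoc,
      sub_self]
  have hconst := is_const_of_deriv_eq_zero (fun s => (hF s).differentiableAt)
    (fun s => (hF s).deriv) 1 0
  simpa only [u, one_smul, zero_smul, NormedSpace.exp_zero,
    one_apply_eq_self] using hconst

variable [NormedAddCommGroup H] [NormedSpace ℂ H] [CompleteSpace H]

theorem map_nhds_exp_apply {ad : E →L[ℂ] E →L[ℂ] E} {j : H →L[ℂ] E} {y : H}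
    (hy : j.range ⊔ (ad.flip (j y)).range = ⊤) :
    map (fun p : H × E => NormedSpace.exp (ad p.2) (j p.1)) (𝓝 (y, 0)) = 𝓝 (j y) := by
  let D : H × E →L[ℂ] E := j.coprod (ad.flip (j y))
  have hexp : HasStrictFDerivAt (NormedSpace.exp : (E →L[ℂ] E) → (E →L[ℂ] E))
      (1 : (E →L[ℂ] E) →L[ℂ] (E →L[ℂ] E)) (ad (0 : E)) := by
    rw [map_zero]; exact hasStrictFDerivAt_exp_zero
  have hderiv : HasStrictFDerivAt (fun p : H × E => NormedSpace.exp (ad p.2) (j p.1)) D (y, 0) := by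
    refine ((hexp.comp (y, (0 : E)) (ad.hasStrictFDerivAt.comp _ hasStrictFDerivAt_snd)).clm_apply
      (j.hasStrictFDerivAt.comp _ hasStrictFDerivAt_fst)).congr_fderiv ?_
    ext p <;> simp [D]
  have hmap := hderiv.map_nhds_eq_of_surj (by rw [ContinuousLinearMap.range_coprod, hy])
  rwa [map_zero, NormedSpace.exp_zero] at hmap

theorem trace_mul_pow_eq_zero_of_range_sup_eq_top {τ : A →L[ℂ] ℂ}
    (hτ : ∀ a b, τ (a * b) = τ (b * a)) {θ : A} {ρ : E →L[ℂ] A} (hθ : ∀ x, Commute θ (ρ x))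
    {ad : E →L[ℂ] E →L[ℂ] E} (hρ : ∀ x y, ρ (ad x y) = ⁅ρ x, ρ y⁆) {j : H →L[ℂ] E} {y : H}
    (hy : j.range ⊔ (ad.flip (j y)).range = ⊤) {k : ℕ}
    (hj : ∀ z, τ (θ * ρ (j z) ^ k) = 0) (a : E) : τ (θ * ρ a ^ k) = 0 := by
  have hanalytic : AnalyticOnNhd ℂ (fun b => τ (θ * ρ b ^ k)) Set.univ := fun b _ =>
    (τ.analyticAt _).comp (analyticAt_const.mul ((ρ.analyticAt b).pow k))
  have hlocal : ∀ᶠ b in 𝓝 (j y), τ (θ * ρ b ^ k) = 0 := by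
    rw [← map_nhds_exp_apply hy, eventually_map]
    exact .of_forall fun p => (trace_mul_pow_exp_ad τ hτ hθ hρ k p.2 (j p.1)).trans (hj p.1)
  exact congrFun (hanalytic.eq_of_eventuallyEq (fun _ _ => analyticAt_const) hlocal) a

theorem trace_mul_toEnd_pow_eq_zero_of_cartan {L V : Type*} [LieRing L] [LieAlgebra ℂ L]
    [FiniteDimensional ℂ L] (h : LieSubalgebra ℂ L) [h.IsCartanSubalgebra] [AddCommGroup V]
    [Module ℂ V] [FiniteDimensional ℂ V] [LieRingModule L V] [LieModule ℂ L V]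
    (θ : V →ₗ⁅ℂ,L⁆ V) {k : ℕ}
    (hθ : ∀ y : h, LinearMap.trace ℂ V (θ * LieModule.toEnd ℂ L V y ^ k) = 0) (a : L) :
    LinearMap.trace ℂ V (θ * LieModule.toEnd ℂ L V a ^ k) = 0 := by
  let toMatrix := LinearMap.toMatrixAlgEquiv (Module.finBasis ℂ V)
  let coord := (Module.finBasis ℂ L).equivFun
  let _ : NormedRing (Matrix (Fin (Module.finrank ℂ V)) (Fin (Module.finrank ℂ V)) ℂ) :=
    Matrix.linftyOpNormedRing
  let _ : NormedAlgebra ℂ (Matrix (Fin (Module.finrank ℂ V)) (Fin (Module.finrank ℂ V)) ℂ) :=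
    Matrix.linftyOpNormedAlgebra
  let _ : NormedRing (Module.End ℂ V) := .induced _ _ toMatrix toMatrix.injective
  let _ : NormedAlgebra ℂ (Module.End ℂ V) := .induced _ _ _ toMatrix
  let _ : NormedAddCommGroup L := .induced _ _ coord coord.injective
  let _ : NormedSpace ℂ L := .induced _ _ _ coord
  have : CompleteSpace L := FiniteDimensional.complete ℂ L
  have : CompleteSpace h := FiniteDimensional.complete ℂ h.toSubmodule
  obtain ⟨y, hy⟩ := exists_cartan_sup_range_ad_eq_top h
  refine trace_mul_pow_eq_zero_of_range_sup_eq_top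
    (τ := (LinearMap.trace ℂ V).toContinuousLinearMap) (θ := (θ : Module.End ℂ V))
    (ρ := (LieModule.toEnd ℂ L V : L →ₗ[ℂ] Module.End ℂ V).toContinuousLinearMap)
    (ad := (LinearMap.toContinuousLinearMap.toLinearMap ∘ₗ
      (LieAlgebra.ad ℂ L : L →ₗ[ℂ] Module.End ℂ L)).toContinuousLinearMap)
    (j := h.toSubmodule.subtypeL) (y := y) (LinearMap.trace_mul_comm ℂ) ?_ ?_ ?_ hθ a
  · exact fun x => LinearMap.ext (θ.map_lie x)
  · exact fun x y => LinearMap.ext (lie_lie x y)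
  · rw [Submodule.toLinearMap_subtypeL, Submodule.range_subtype, ← hy,
      ← LinearMap.range_neg (LieAlgebra.ad ℂ L y)]
    congr 2
    ext x
    exact (lie_skew x (y : L)).symm

end InvariantFunctions

section Descent

theorem SMod.strSeries_eq_zero_of_sch_eq_zero [FiniteDimensional ℂ g]
    (h : LieSubalgebra ℂ (part g 0)) [h.IsCartanSubalgebra] {M : SMod.{u, v} g}
    (hM : sch h M = 0) {a : g} (ha : a ∈ part g 0) : M.strSeries a = 0 := by
  refine expTrace_eq_zero_iff.mpr fun k =>
    trace_mul_toEnd_pow_eq_zero_of_cartan h M.parHom (fun y => ?_) ⟨a, ha⟩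
  refine expTrace_eq_zero_iff.mp ((expEval_sch h M y).symm.trans ?_) k
  rw [hM, map_zero, Pi.zero_apply]

variable {x : SelfCommuting g} (t : LieSubalgebra ℂ (part (DSAlg x) 0)) [LieRing.IsNilpotent t]

theorem sch_DS_eq_zero_of_sch_eq_zero [FiniteDimensional ℂ g] (h : LieSubalgebra ℂ (part g 0))
    [h.IsCartanSubalgebra] {M : SMod.{u, v} g} (hM : sch h M = 0) : sch t (M.DS x) = 0 := by
  refine expEval_injective (funext fun a => ?_)
  obtain ⟨c, hc, hca⟩ := (SuperRep.adjoint g).exists_homog_rep x (a : part (DSAlg x) 0).2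
  rw [expEval_sch, map_zero, Pi.zero_apply, ← hca]
  exact (M.strSeries_DS x c hc).trans (SMod.strSeries_eq_zero_of_sch_eq_zero h hM hc)

theorem JRing.existsUnique_ds [FiniteDimensional ℂ g] (h : LieSubalgebra ℂ (part g 0))
    [h.IsCartanSubalgebra] :
    ∃! φ : JRing.{u, v} h →+* JRing.{u, v} t,
      ∀ M : SMod.{u, v} g, φ (cls h M) = cls t (M.DS x) := by
  obtain ⟨ds, hds, -⟩ := KRing.existsUnique_ds.{u, v} x
  have hker : RingHom.ker (KRing.toJRing h) ≤ RingHom.ker ((KRing.toJRing t).comp ds) := by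
    refine KRing.cls_surjective.forall.mpr fun M hM => ?_
    rw [RingHom.mem_ker, KRing.toJRing_cls] at hM
    rw [RingHom.mem_ker, RingHom.comp_apply, hds, KRing.toJRing_cls]
    exact Subtype.ext (sch_DS_eq_zero_of_sch_eq_zero t h (congrArg Subtype.val hM))
  let dsJ := RingHom.liftOfSurjective _ (KRing.toJRing_surjective h) ⟨_, hker⟩
  have hdsJ (M : SMod.{u, v} g) : dsJ (cls h M) = cls t (M.DS x) := by
    rw [← KRing.toJRing_cls, ← KRing.toJRing_cls, ← hds]
    exact RingHom.liftOfRightInverse_comp_apply _ _ _ _ _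
  exact ⟨dsJ, hdsJ, fun φ hφ =>
    RingHom.ext ((cls_surjective h).forall.mpr fun M => (hφ M).trans (hdsJ M).symm)⟩

theorem sch_DS_eq_restrictExp (h : LieSubalgebra ℂ (part g 0)) [LieRing.IsNilpotent h]
    (ι : t →ₗ[ℂ] h) (hι : IsEmbeddingInto ι) (M : SMod.{u, v} g) :
    sch t (M.DS x) = restrictExp ι (sch h M) := by
  refine expEval_injective (funext fun a => ?_)
  obtain ⟨c, hc, hca⟩ := hι a
  rw [expEval_restrictExp, expEval_sch, expEval_sch, ← hca, ← hc]
  exact M.strSeries_DS x c (hc ▸ (ι a : part g 0).2)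

end Descent

end Super

end

theorem mainTheorem1_general {g : Type u} [AddCommGroup g] [Module ℂ g] [FiniteDimensional ℂ g]
    [Super.LieSuperalgebra g] (h : LieSubalgebra ℂ (Super.part g 0)) [h.IsCartanSubalgebra]
    (x : Super.SelfCommuting g) :
    (∃! ds : Super.KRing.{u, v} g →+* Super.KRing.{u, v} (Super.DSAlg x),
      ∀ M : Super.SMod.{u, v} g, ds (Super.KRing.cls M) = Super.KRing.cls (M.DS x)) ∧
    (Super.JRing.{u, v} h : Set (AddMonoidAlgebra ℤ (Module.Dual ℂ h))) =
      Set.range (Super.sch.{u, v} h) ∧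
    ∀ (t : LieSubalgebra ℂ (Super.part (Super.DSAlg x) 0)) [LieRing.IsNilpotent t],
      (Super.JRing.{u, v} t : Set (AddMonoidAlgebra ℤ (Module.Dual ℂ t))) =
        Set.range (Super.sch.{u, v} t) ∧
      (∃! ds : Super.JRing.{u, v} h →+* Super.JRing.{u, v} t,
        ∀ M : Super.SMod.{u, v} g, ds (Super.JRing.cls h M) = Super.JRing.cls t (M.DS x)) ∧
      (∀ ι : t →ₗ[ℂ] h, Super.IsEmbeddingInto ι → ∀ M : Super.SMod.{u, v} g,
        Super.sch t (M.DS x) = Super.restrictExp ι (Super.sch h M)) :=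
  ⟨Super.KRing.existsUnique_ds x, Super.coe_JRing h, fun t _ =>
    ⟨Super.coe_JRing t, Super.JRing.existsUnique_ds t h, Super.sch_DS_eq_restrictExp t h⟩⟩

theorem mainTheorem1 {g : Type u} [AddCommGroup g] [Module ℂ g] [FiniteDimensional ℂ g]
    [Super.LieSuperalgebra g] (h : LieSubalgebra ℂ (Super.part g 0)) [h.IsCartanSubalgebra]
    (_hg : Super.ContragredientData h) (x : Super.SelfCommuting g) (_hx : x.elt ≠ 0) :
    (∃! ds : Super.KRing.{u, v} g →+* Super.KRing.{u, v} (Super.DSAlg x),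
      ∀ M : Super.SMod.{u, v} g, ds (Super.KRing.cls M) = Super.KRing.cls (M.DS x)) ∧
    (Super.JRing.{u, v} h : Set (AddMonoidAlgebra ℤ (Module.Dual ℂ h))) =
      Set.range (Super.sch.{u, v} h) ∧
    ∀ (t : LieSubalgebra ℂ (Super.part (Super.DSAlg x) 0)) [t.IsCartanSubalgebra],
      (Super.JRing.{u, v} t : Set (AddMonoidAlgebra ℤ (Module.Dual ℂ t))) =
        Set.range (Super.sch.{u, v} t) ∧
      (∃! ds : Super.JRing.{u, v} h →+* Super.JRing.{u, v} t,
        ∀ M : Super.SMod.{u, v} g, ds (Super.JRing.cls h M) = Super.JRing.cls t (M.DS x)) ∧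
      (∀ ι : t →ₗ[ℂ] h, Super.IsEmbeddingInto ι → ∀ M : Super.SMod.{u, v} g,
        Super.sch t (M.DS x) = Super.restrictExp ι (Super.sch h M)) :=
  let ⟨existsUnique_ds, coe_JRing, forall_t⟩ := mainTheorem1_general h x
  ⟨existsUnique_ds, coe_JRing, fun t _ => forall_t t⟩
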